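/- For $f\in L^2(\mathbb R^2)$ and $t\in\mathbb R$ let $$e^{it\square}f(x)=\int_{\mathbb R^2}e^{i(x\cdot\xi+t\xi_1\xi_2)}\,\widehat f(\xi)\,d\xi,\qquad \widehat f(\xi)=(2\pi)^{-2}\int_{\mathbb R^2} e^{-ix\cdot\xi}f(x)\,dx,$$ where both integrals are understood in the $L^2$ sense (Plancherel); that is, $e^{it\square}$ is the Fourier multiplier with symbol $e^{it\xi_1\xi_2}$. For $s\ge 0$ let $H^s(\mathbb R^2)$ be the space of all $f\in L^2(\mathbb R^2)$ with $(1+|\xi|^2)^{s/2}\widehat f\in L^2(\mathbb R^2)$. For $r>0$, a sequence $(t_n)_{n\ge1}$ of positive numbers belongs to $\ell^{r,\infty}(\mathbb N)$ if $\sup_{b>0} b^r\,\#\{n: t_n>b\}<\infty$. **Theorem 1.1.** Let $0<s<\tfrac12$, and let $(t_n)_{n\ge1}\subset(0,1)$ be a decreasing sequence converging to $0$ such that $(t_n-t_{n+1})_{n\ge1}$ is also decreasing. Then $$\lim_{n\to\infty}e^{it_n\square}f(x)=f(x)\quad\text{for a.e. }x\in\mathbb R^2$$ holds for every $f\in H^s(\mathbb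 R^2)$ if and only if $(t_n)\in\ell^{r(s),\infty}(\mathbb N)$, where $r(s)=\dfrac{s}{1-s}$. -/

import Mathlib

open MeasureTheory Filter Topology FourierTransform
open scoped ENNReal SchwartzMap

noncomputable section

/-- The plane `ℝ²` with its Euclidean norm and Lebesgue measure. -/
abbrev Plane : Type := EuclideanSpace ℝ (Fin 2)

/-- The symbol `exp (i t ξ₁ ξ₂)` of `e^{it□}`. Mathlib's Fourier transform is
`∫ exp (-2 π i x·η) f x dx`, so its frequency variable `η` is `ξ / (2 π)`. -/
def boxSymbol (t : ℝ) (η : Plane) : ℂ :=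
  Complex.exp (Complex.I * ((t * ((2 * Real.pi * η 0) * (2 * Real.pi * η 1)) : ℝ) : ℂ))

theorem memLp_top_boxSymbol (t : ℝ) : MemLp (boxSymbol t) ∞ (volume : Measure Plane) := by
  refine memLp_top_of_bound (C := 1) ?_ (Eventually.of_forall fun η => ?_)
  · refine Continuous.aestronglyMeasurable ?_
    unfold boxSymbol
    fun_prop
  · rw [boxSymbol, mul_comm, Complex.norm_exp_ofReal_mul_I]

/-- The nonelliptic Schrödinger mean
`e^{it□} f (x) = ∫ exp (i (x·ξ + t ξ₁ ξ₂)) f̂(ξ) dξ` of `f ∈ L²(ℝ²)`, where `f̂` is normalized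
so that `t = 0` gives `f`, and the integral is read through the `L²` Fourier transform. -/
def boxMean (t : ℝ) (f : Lp ℂ 2 (volume : Measure Plane)) : Lp ℂ 2 (volume : Measure Plane) :=
  𝓕⁻ (((memLp_top_boxSymbol t).toLp (boxSymbol t) • 𝓕 f : Lp ℂ 2 (volume : Measure Plane)))

/-- The sequence `t` lies in the weak Lorentz space `ℓ^{r,∞}(ℕ)`:
`sup_{b > 0} b ^ r * #{n : t n > b} < ∞`, where `#` is `∞` on infinite sets. -/
def MemWeakLorentz (r : ℝ) (t : ℕ → ℝ) : Prop :=
  (⨆ b : Set.Ioi (0 : ℝ), ENNReal.ofReal ((b : ℝ) ^ r) * (Set.encard {n | (b : ℝ) < t n} : ℝ≥0∞))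
    < ∞

end

/-! Write `r = s/(1-s)`, so that `(1+r)s = r`, and `r < 1` because `s < 1/2`.

Sufficiency. About `2^{lr}` of the times lie in the block `t_n ~ 2^{-l}`. Over a time increment `δ`
the symbol changes by at most a constant times `min(1, √δ|ξ|)` in square. Chaining over the dyadic
grid of mesh `δ = 2^{-l(1+r)}`, which has about `2^{lr}` points in `[0, 2^{-l})`, bounds the `L²`
norm squared of `sup |e^{it_n□}f - f|` over the block by `2^{lr} ∫ min(1, √δ|ξ|)|f̂|²` up to a
constant (`exists_chaining_bound`). Summing over `l` gives the weight `|ξ|^{2r/(1+r)} = |ξ|^{2s}`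
(`exists_tsum_scales_le`). Hence for `f ∈ H^s` the squared block maxima have an integrable sum, and
tend to `0` almost everywhere.

Necessity. If convergence holds on all of `H^s`, Banach's principle
(`exists_uniform_maxFunctional_le`) makes the maximal function uniformly small in measure for small
data. If the weak Lorentz condition fails, monotone gaps make the times `b/N`-dense in `[0,b]` for
arbitrarily small `b`, with `N` any multiple of `b^{-r}` (`exists_dense_times`). Put `c = √(N/b)`.
Near frequency `(0,c)` the flow is translation by `tc` in `x₁`. A train of bumps of width `1/c` and
spacing `N/c` in `x₁`, modulated by `e^{icx₂}`, is swept over the whole unit square by the `N`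
times, while its `H^s` norm squared is only `c^{2s}/N = N^{s-1}b^{-s}`, small for `N ≫ b^{-r}`. The
translation error `(N/c)² = Nb` is small because `r < 1` (`exists_test_function`,
`exists_bad_scale`). -/

/-! ### Time increments of the flow on the Fourier side. -/

theorem norm_boxSymbol (t : ℝ) (η : Plane) : ‖boxSymbol t η‖ = 1 := by
  rw [boxSymbol, mul_comm, Complex.norm_exp_ofReal_mul_I]

theorem abs_coord_mul_le (η : Plane) : |η 0 * η 1| ≤ ‖η‖ ^ 2 := by
  rw [EuclideanSpace.norm_sq_eq, Fin.sum_univ_two, abs_mul, Real.norm_eq_abs, Real.norm_eq_abs]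
  nlinarith [sq_nonneg (|η 0| - |η 1|), sq_nonneg (|η 0|), sq_nonneg (|η 1|)]

theorem norm_exp_sub_exp_le (a b : ℝ) :
    ‖Complex.exp (Complex.I * a) - Complex.exp (Complex.I * b)‖ ≤ |a - b| := by
  have h : Complex.exp (Complex.I * a) - Complex.exp (Complex.I * b)
      = Complex.exp (Complex.I * b) * (Complex.exp (Complex.I * ((a - b : ℝ) : ℂ)) - 1) := by
    rw [mul_sub, ← Complex.exp_add, mul_one]
    congr 2
    push_cast
    ring
  rw [h, norm_mul, mul_comm Complex.I (b : ℂ), Complex.norm_exp_ofReal_mul_I, one_mul]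
  exact Real.norm_exp_I_mul_ofReal_sub_one_le

/-- The fourth power `y ^ 4` is deliberately weakened to `y`. With `y` proportional to `√δ`, the
bound then grows only by `√2` when `δ` doubles, less than the factor 2 by which the number of grid
points drops, so the finest scale dominates in the chaining. -/
theorem sq_le_four_mul_min {u y : ℝ} (hu : 0 ≤ u) (hy : 0 ≤ y) (hu2 : u ≤ 2) (huy : u ≤ y ^ 2) :
    u ^ 2 ≤ 4 * min 1 y := by
  rw [mul_min_of_nonneg _ _ (by norm_num : (0 : ℝ) ≤ 4)]
  refine le_min (by nlinarith) ?_
  rcases le_total y 1 with h | h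
  · have h1 : u ^ 2 ≤ (y ^ 2) ^ 2 := by gcongr
    have h2 : (y ^ 2) ^ 2 ≤ y := by
      have : y ^ 4 ≤ y ^ 1 := pow_le_pow_of_le_one hy h (by norm_num)
      calc (y ^ 2) ^ 2 = y ^ 4 := by ring
        _ ≤ y := by simpa using this
    linarith
  · nlinarith

/-- The modulus of continuity in time of the symbol, with half a derivative. -/
theorem norm_boxSymbol_sub_sq_le {t t' δ : ℝ} (h : |t - t'| ≤ δ) (η : Plane) :
    ‖boxSymbol t η - boxSymbol t' η‖ ^ 2 ≤ 4 * min 1 (√δ * (2 * Real.pi * ‖η‖)) := by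
  have hδ : 0 ≤ δ := (abs_nonneg _).trans h
  refine sq_le_four_mul_min (norm_nonneg _) (by positivity) ?_ ?_
  · refine (norm_sub_le _ _).trans ?_
    rw [norm_boxSymbol, norm_boxSymbol]
    norm_num
  · refine (norm_exp_sub_exp_le _ _).trans ?_
    have : t * (2 * Real.pi * η 0 * (2 * Real.pi * η 1))
        - t' * (2 * Real.pi * η 0 * (2 * Real.pi * η 1))
        = (t - t') * ((2 * Real.pi) ^ 2 * (η 0 * η 1)) := by ring
    rw [this, abs_mul, abs_mul, abs_of_nonneg (by positivity : 0 ≤ (2 * Real.pi) ^ 2), mul_pow √δ,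
      Real.sq_sqrt hδ, mul_pow (2 * Real.pi) ‖η‖]
    have := abs_coord_mul_le η
    gcongr

theorem coeFn_fourier_boxMean (t : ℝ) (f : Lp ℂ 2 (volume : Measure Plane)) :
    ⇑(𝓕 (boxMean t f) : Lp ℂ 2 (volume : Measure Plane)) =ᵐ[volume]
      fun η => boxSymbol t η * (𝓕 f : Lp ℂ 2 volume) η := by
  rw [boxMean, FourierTransform.fourier_fourierInv_eq]
  filter_upwards [Lp.coeFn_lpSMul (r := 2) ((memLp_top_boxSymbol t).toLp (boxSymbol t))
    (𝓕 f : Lp ℂ 2 (volume : Measure Plane)), (memLp_top_boxSymbol t).coeFn_toLp] with x h1 h2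
  rw [h1, Pi.smul_apply', h2, smul_eq_mul]

theorem Lp.enorm_sq_eq_lintegral (f : Lp ℂ 2 (volume : Measure Plane)) :
    ‖f‖ₑ ^ 2 = ∫⁻ x, ‖f x‖ₑ ^ 2 := by
  rw [Lp.enorm_def]
  have := eLpNorm_nnreal_pow_eq_lintegral (f := f) (μ := (volume : Measure Plane))
    (p := 2) (by norm_num)
  simpa using this

theorem lintegral_enorm_sq_fourier (f : Lp ℂ 2 (volume : Measure Plane)) :
    ∫⁻ x, ‖(𝓕 f : Lp ℂ 2 volume) x‖ₑ ^ 2 = ∫⁻ x, ‖f x‖ₑ ^ 2 := by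
  rw [← Lp.enorm_sq_eq_lintegral, ← Lp.enorm_sq_eq_lintegral]
  congr 1
  rw [← ofReal_norm, ← ofReal_norm, Lp.norm_fourier_eq]

/-- Plancherel for the difference of two `L²` functions. -/
theorem lintegral_enorm_sub_sq (f g : Lp ℂ 2 (volume : Measure Plane)) :
    ∫⁻ x, ‖f x - g x‖ₑ ^ 2 =
      ∫⁻ η, ‖(𝓕 f : Lp ℂ 2 volume) η - (𝓕 g : Lp ℂ 2 volume) η‖ₑ ^ 2 := by
  have h1 : ∫⁻ x, ‖f x - g x‖ₑ ^ 2 = ∫⁻ x, ‖(f - g) x‖ₑ ^ 2 := by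
    refine lintegral_congr_ae ?_
    filter_upwards [Lp.coeFn_sub f g] with x hx
    rw [hx, Pi.sub_apply]
  have h2 : 𝓕 (f - g) = 𝓕 f - 𝓕 g := (Lp.fourierTransformₗᵢ Plane ℂ).map_sub f g
  rw [h1, ← lintegral_enorm_sq_fourier, h2]
  refine lintegral_congr_ae ?_
  filter_upwards [Lp.coeFn_sub (𝓕 f) (𝓕 g)] with x hx
  rw [hx, Pi.sub_apply]

theorem lintegral_boxMean_sub_sq (t t' : ℝ) (f : Lp ℂ 2 (volume : Measure Plane)) :
    ∫⁻ x, ‖boxMean t f x - boxMean t' f x‖ₑ ^ 2 =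
      ∫⁻ η, ‖boxSymbol t η - boxSymbol t' η‖ₑ ^ 2 * ‖(𝓕 f : Lp ℂ 2 volume) η‖ₑ ^ 2 := by
  rw [lintegral_enorm_sub_sq]
  refine lintegral_congr_ae ?_
  filter_upwards [coeFn_fourier_boxMean t f, coeFn_fourier_boxMean t' f] with x h1 h2
  rw [h1, h2, ← sub_mul, enorm_mul, mul_pow]

theorem boxMean_zero (f : Lp ℂ 2 (volume : Measure Plane)) : boxMean 0 f = f := by
  have : 𝓕 (boxMean 0 f) = 𝓕 f := by
    refine Lp.ext ?_
    filter_upwards [coeFn_fourier_boxMean 0 f] with x h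
    rw [h]
    simp [boxSymbol]
  exact (Lp.fourierTransformₗᵢ Plane ℂ).injective this

/-- The `L²` size on the Fourier side controlling time increments of length `δ`. -/
noncomputable def incrementBound (f : Lp ℂ 2 (volume : Measure Plane)) (δ : ℝ) : ℝ≥0∞ :=
  ∫⁻ η, ENNReal.ofReal (4 * min 1 (√δ * (2 * Real.pi * ‖η‖))) * ‖(𝓕 f : Lp ℂ 2 volume) η‖ₑ ^ 2

theorem lintegral_boxMean_sub_sq_le {t t' δ : ℝ} (h : |t - t'| ≤ δ)
    (f : Lp ℂ 2 (volume : Measure Plane)) :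
    ∫⁻ x, ‖boxMean t f x - boxMean t' f x‖ₑ ^ 2 ≤ incrementBound f δ := by
  rw [lintegral_boxMean_sub_sq]
  refine lintegral_mono fun η => ?_
  gcongr
  rw [← ofReal_norm, ← ENNReal.ofReal_pow (norm_nonneg _)]
  exact ENNReal.ofReal_le_ofReal (norm_boxSymbol_sub_sq_le h η)

/-- `17/12` is a rational upper bound for `√2`, the growth of `√δ` under doubling. -/
theorem incrementBound_two_pow_mul (f : Lp ℂ 2 (volume : Measure Plane)) (δ : ℝ) (m : ℕ) :
    incrementBound f (2 ^ m * δ) ≤ ENNReal.ofReal ((17 / 12) ^ m) * incrementBound f δ := by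
  unfold incrementBound
  rw [← lintegral_const_mul' _ _ ENNReal.ofReal_ne_top]
  refine lintegral_mono fun η => ?_
  rw [← mul_assoc (ENNReal.ofReal ((17 / 12) ^ m)), ← ENNReal.ofReal_mul (by positivity)]
  refine mul_le_mul_left (ENNReal.ofReal_le_ofReal ?_) _
  have h1 : √(2 ^ m * δ) ≤ (17 / 12) ^ m * √δ := by
    rw [Real.sqrt_mul (by positivity)]
    gcongr
    rw [Real.sqrt_le_left (by positivity), ← pow_mul, mul_comm, pow_mul]
    gcongr
    norm_num
  have h2 : (1 : ℝ) ≤ (17 / 12) ^ m := one_le_pow₀ (by norm_num)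
  have h3 : 0 ≤ 2 * Real.pi * ‖η‖ := by positivity
  rw [mul_left_comm ((17 / 12 : ℝ) ^ m),
    mul_min_of_nonneg _ _ (by positivity : (0 : ℝ) ≤ (17 / 12) ^ m)]
  refine mul_le_mul_of_nonneg_left (min_le_min (h2.trans_eq (mul_one _).symm) ?_) (by norm_num)
  rw [← mul_assoc ((17 / 12 : ℝ) ^ m)]
  exact mul_le_mul_of_nonneg_right h1 h3

/-! ### Bessel weights and the Sobolev space. -/

/-- The symbol of the Bessel potential of order `-s`. -/
noncomputable def besselWeight (s : ℝ) (η : Plane) : ℂ := (((1 + ‖η‖ ^ 2) ^ (-s / 2) : ℝ) : ℂ)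

theorem norm_besselWeight (s : ℝ) (η : Plane) :
    ‖besselWeight s η‖ = (1 + ‖η‖ ^ 2) ^ (-s / 2) := by
  rw [besselWeight, Complex.norm_real, Real.norm_eq_abs, abs_of_nonneg (by positivity)]

theorem norm_besselWeight_sq (s : ℝ) (η : Plane) :
    ‖besselWeight s η‖ ^ 2 = (1 + ‖η‖ ^ 2) ^ (-s) := by
  rw [norm_besselWeight, ← Real.rpow_mul_natCast (by positivity)]
  congr 1
  push_cast
  ring

theorem memLp_top_besselWeight {s : ℝ} (hs : 0 ≤ s) :
    MemLp (besselWeight s) ∞ (volume : Measure Plane) := by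
  refine memLp_top_of_bound (C := 1) ?_ (Eventually.of_forall fun η => ?_)
  · refine Continuous.aestronglyMeasurable ?_
    have : (besselWeight s).HasTemperateGrowth := by
      unfold besselWeight
      fun_prop
    exact this.1.continuous
  · rw [norm_besselWeight]
    exact Real.rpow_le_one_of_one_le_of_nonpos (by simp) (by linarith)

/-- Multiplication of an `L²` function by the Bessel weight. -/
noncomputable def besselMul {s : ℝ} (hs : 0 ≤ s) (g : Lp ℂ 2 (volume : Measure Plane)) :
    Lp ℂ 2 (volume : Measure Plane) :=
  ((memLp_top_besselWeight hs).toLp (besselWeight s) • g : Lp ℂ 2 (volume : Measure Plane))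

theorem coeFn_besselMul {s : ℝ} (hs : 0 ≤ s) (g : Lp ℂ 2 (volume : Measure Plane)) :
    ⇑(besselMul hs g) =ᵐ[volume] fun η => besselWeight s η * g η := by
  rw [besselMul]
  filter_upwards [Lp.coeFn_lpSMul (r := 2) ((memLp_top_besselWeight hs).toLp (besselWeight s)) g,
    (memLp_top_besselWeight hs).coeFn_toLp] with x h1 h2
  rw [h1, Pi.smul_apply', h2, smul_eq_mul]

/-- The weights with exponents `±s/2` are mutually inverse multipliers on tempered distributions,
and `L²` embeds there injectively. This parametrizes `H^s` by the complete space `L²`, on which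
Baire's theorem will be applied. -/
theorem memSobolev_iff_exists_fourier_eq_besselMul {s : ℝ} (hs : 0 ≤ s)
    (f : Lp ℂ 2 (volume : Measure Plane)) :
    TemperedDistribution.MemSobolev s 2 (f : 𝓢'(Plane, ℂ)) ↔
      ∃ g : Lp ℂ 2 (volume : Measure Plane), 𝓕 f = besselMul hs g := by
  have hW : (besselWeight s).HasTemperateGrowth := by
    unfold besselWeight
    fun_prop
  have hV : (fun x : Plane => (((1 + ‖x‖ ^ 2) ^ (s / 2) : ℝ) : ℂ)).HasTemperateGrowth := by
    fun_prop
  have hWV : besselWeight s * (fun x : Plane => (((1 + ‖x‖ ^ 2) ^ (s / 2) : ℝ) : ℂ))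
      = fun _ => 1 := by
    ext x
    rw [Pi.mul_apply, besselWeight]
    norm_cast
    rw [← Real.rpow_add (by positivity), neg_div, neg_add_cancel, Real.rpow_zero]
  have key : ∀ g : Lp ℂ 2 (volume : Measure Plane),
      ((besselMul hs g : Lp ℂ 2 (volume : Measure Plane)) : 𝓢'(Plane, ℂ))
        = TemperedDistribution.smulLeftCLM ℂ (besselWeight s) (g : 𝓢'(Plane, ℂ)) := fun g =>
    Lp.toTemperedDistribution_smul_eq hW (memLp_top_besselWeight hs) g
  have hinj : Function.Injective
      (MeasureTheory.Lp.toTemperedDistributionCLM ℂ (volume : Measure Plane) 2) :=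
    LinearMap.ker_eq_bot.mp MeasureTheory.Lp.ker_toTemperedDistributionCLM_eq_bot
  rw [TemperedDistribution.memSobolev_iff_exists_smulLeftCLM_fourier,
    Lp.fourier_toTemperedDistribution_eq]
  refine exists_congr fun g => ⟨fun h => hinj ?_, fun h => ?_⟩
  · rw [Lp.toTemperedDistributionCLM_apply, Lp.toTemperedDistributionCLM_apply, key, ← h,
      TemperedDistribution.smulLeftCLM_smulLeftCLM_apply (by fun_prop) (by fun_prop),
      mul_comm, hWV, TemperedDistribution.smulLeftCLM_const, one_smul]
  · rw [h, key, TemperedDistribution.smulLeftCLM_smulLeftCLM_apply (by fun_prop) (by fun_prop),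
      hWV, TemperedDistribution.smulLeftCLM_const, one_smul]

/-! ### Dyadic chaining in time. -/

theorem geom_sum_le_inv_one_sub {ρ : ℝ} (h0 : 0 ≤ ρ) (h1 : ρ < 1) (J : ℕ) :
    ∑ m ∈ Finset.range J, ρ ^ m ≤ (1 - ρ)⁻¹ := by
  rw [← tsum_geometric_of_lt_one h0 h1]
  exact (summable_geometric_of_lt_one h0 h1).sum_le_tsum _ fun _ _ => by positivity

/-- Cauchy–Schwarz with weights `(5/6)^m`, whose sum is at most 6. The ratio `6/5` is small enough
that `(6/5)(17/12) < 2`. -/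
theorem add_sum_sq_le (a : ℝ) (d : ℕ → ℝ) (J : ℕ) :
    (a + ∑ m ∈ Finset.range J, d m) ^ 2 ≤
      2 * a ^ 2 + 12 * ∑ m ∈ Finset.range J, (6 / 5) ^ m * d m ^ 2 := by
  have h1 : (∑ m ∈ Finset.range J, d m) ^ 2 ≤
      (∑ m ∈ Finset.range J, (5 / 6 : ℝ) ^ m) *
        ∑ m ∈ Finset.range J, (6 / 5) ^ m * d m ^ 2 := by
    refine Finset.sum_sq_le_sum_mul_sum_of_sq_le_mul _ (fun _ _ => by positivity)
      (fun _ _ => by positivity) fun m _ => le_of_eq ?_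
    rw [← mul_assoc, ← mul_pow]
    norm_num
  have h2 : ∑ m ∈ Finset.range J, (5 / 6 : ℝ) ^ m ≤ 6 := by
    refine (geom_sum_le_inv_one_sub (by norm_num) (by norm_num) J).trans ?_
    norm_num
  have h3 : 0 ≤ ∑ m ∈ Finset.range J, (6 / 5) ^ m * d m ^ 2 :=
    Finset.sum_nonneg fun _ _ => by positivity
  nlinarith [sq_nonneg (a - ∑ m ∈ Finset.range J, d m), mul_le_mul_of_nonneg_right h2 h3]

/-- The binary digits of `k` are cleared one at a time from the lowest: `k / 2 ^ m` is replaced by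
the even number below it, which is the level `m + 1` point. After `J` digits time 0 is reached. -/
theorem norm_sub_le_chain (G : ℝ → ℂ) (τ δ : ℝ) (k J : ℕ) (hk : k < 2 ^ J) :
    ‖G τ - G 0‖ ≤ ‖G τ - G (δ * k)‖ + ∑ m ∈ Finset.range J,
      ‖G (2 ^ m * δ * (k / 2 ^ m : ℕ)) - G (2 ^ m * δ * (2 * (k / 2 ^ m / 2) : ℕ))‖ := by
  have h : G (δ * k) - G 0 = ∑ m ∈ Finset.range J,
      (G (2 ^ m * δ * (k / 2 ^ m : ℕ)) - G (2 ^ m * δ * (2 * (k / 2 ^ m / 2) : ℕ))) := by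
    have := Finset.sum_range_sub' (fun m => G (2 ^ m * δ * (k / 2 ^ m : ℕ))) J
    simp only [pow_zero, one_mul, Nat.div_one, Nat.div_eq_of_lt hk, Nat.cast_zero, mul_zero]
      at this
    rw [← this]
    refine Finset.sum_congr rfl fun m _ => ?_
    congr 2
    rw [Nat.div_div_eq_div_mul, ← pow_succ]
    push_cast
    ring
  calc ‖G τ - G 0‖ = ‖(G τ - G (δ * k)) + (G (δ * k) - G 0)‖ := by ring_nf
    _ ≤ _ := by
      refine (norm_add_le _ _).trans ?_
      rw [h]
      gcongr
      exact norm_sum_le _ _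

/-- Dyadic chaining: the maximal function of a process with increments of the size of a half
derivative over a finite set of times in `[0, 2 ^ J δ)`. -/
theorem exists_chaining_bound {F : ℝ → Plane → ℂ} (hF : ∀ t, Measurable (F t)) {A : ℝ≥0∞} {δ : ℝ}
    (hδ : 0 < δ) (J : ℕ)
    (hA : ∀ (m : ℕ) (t t' : ℝ), |t - t'| ≤ 2 ^ m * δ →
      ∫⁻ x, ‖F t x - F t' x‖ₑ ^ 2 ≤ ENNReal.ofReal ((17 / 12) ^ m) * A)
    (I : Finset ℕ) (t : ℕ → ℝ) (ht : ∀ n ∈ I, 0 ≤ t n ∧ t n < 2 ^ J * δ) :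
    ∃ B : Plane → ℝ≥0∞, Measurable B ∧ (∀ x, ∀ n ∈ I, ‖F (t n) x - F 0 x‖ₑ ^ 2 ≤ B x) ∧
      ∫⁻ x, B x ≤ (2 * (I.card : ℝ≥0∞) + 80 * 2 ^ J) * A := by
  set k : ℕ → ℕ := fun n => ⌊t n / δ⌋₊ with hk_def
  have hmeas : ∀ t t', Measurable fun x => ‖F t x - F t' x‖ₑ ^ 2 := fun t t' =>
    (((hF t).sub (hF t')).enorm).pow_const 2
  -- Each supremum is replaced by a sum: over the given times for the rounding to the grid, and over
  -- all `2 ^ (J - m)` possible links at level `m`.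
  refine ⟨fun x => 2 * ∑ n ∈ I, ‖F (t n) x - F (δ * k n) x‖ₑ ^ 2 +
    12 * ∑ m ∈ Finset.range J, ENNReal.ofReal ((6 / 5) ^ m) * ∑ j ∈ Finset.range (2 ^ (J - m)),
      ‖F (2 ^ m * δ * (j : ℕ)) x - F (2 ^ m * δ * (2 * (j / 2) : ℕ)) x‖ₑ ^ 2, ?_, ?_, ?_⟩
  · refine ((Finset.measurable_sum _ fun n _ => hmeas _ _).const_mul _).add
      ((Finset.measurable_sum _ fun m _ => ?_).const_mul _)
    exact (Finset.measurable_sum _ fun j _ => hmeas _ _).const_mul _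
  · intro x n hn
    have hkn : k n < 2 ^ J := by
      rw [hk_def]
      refine (Nat.floor_lt (div_nonneg (ht n hn).1 hδ.le)).2 ?_
      rw [div_lt_iff₀ hδ]
      exact_mod_cast (ht n hn).2
    have h1 := norm_sub_le_chain (fun t => F t x) (t n) δ (k n) J hkn
    have h2 := (pow_le_pow_left₀ (norm_nonneg _) h1 2).trans (add_sum_sq_le _ _ _)
    rw [← ofReal_norm, ← ENNReal.ofReal_pow (norm_nonneg _)]
    refine (ENNReal.ofReal_le_ofReal h2).trans ?_
    rw [ENNReal.ofReal_add (by positivity)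
      (mul_nonneg (by norm_num) (Finset.sum_nonneg fun _ _ => by positivity)),
      ENNReal.ofReal_mul (by norm_num), ENNReal.ofReal_mul (by norm_num),
      ENNReal.ofReal_sum_of_nonneg fun _ _ => by positivity]
    have e2 : ENNReal.ofReal 2 = 2 := by norm_num
    have e12 : ENNReal.ofReal 12 = 12 := by norm_num
    rw [e2, e12]
    have hsq : ∀ z : ℂ, ENNReal.ofReal (‖z‖ ^ 2) = ‖z‖ₑ ^ 2 := fun z => by
      rw [ENNReal.ofReal_pow (norm_nonneg _), ofReal_norm]
    refine add_le_add (mul_le_mul_right ?_ _)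
      (mul_le_mul_right (Finset.sum_le_sum fun m hm => ?_) _)
    · rw [hsq]
      exact Finset.single_le_sum (f := fun n => ‖F (t n) x - F (δ * k n) x‖ₑ ^ 2)
        (fun _ _ => zero_le) hn
    · rw [ENNReal.ofReal_mul (by positivity), hsq]
      gcongr
      refine Finset.single_le_sum (f := fun j : ℕ => ‖F (2 ^ m * δ * (j : ℕ)) x -
        F (2 ^ m * δ * (2 * (j / 2) : ℕ)) x‖ₑ ^ 2) (fun _ _ => zero_le) (Finset.mem_range.2 ?_)
      rw [Nat.div_lt_iff_lt_mul (by positivity), ← pow_add,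
        Nat.sub_add_cancel (Finset.mem_range.1 hm).le]
      exact hkn
  · rw [lintegral_add_left ((Finset.measurable_sum _ fun n _ => hmeas _ _).const_mul _),
      lintegral_const_mul _ (Finset.measurable_sum _ fun n _ => hmeas _ _),
      lintegral_finsetSum _ fun n _ => hmeas _ _,
      lintegral_const_mul _ (Finset.measurable_sum _ fun m _ =>
        (Finset.measurable_sum _ fun j _ => hmeas _ _).const_mul _),
      lintegral_finsetSum _ fun m _ => (Finset.measurable_sum _ fun j _ => hmeas _ _).const_mul _,
      add_mul]
    refine add_le_add ?_ ?_
    · rw [mul_assoc, ← nsmul_eq_mul]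
      refine mul_le_mul_right ?_ _
      refine Finset.sum_le_card_nsmul _ _ _ fun n hn => ?_
      have := hA 0 (t n) (δ * k n) ?_
      · simpa using this
      · have h0 : 0 ≤ t n / δ := div_nonneg (ht n hn).1 hδ.le
        have h1 : (k n : ℝ) ≤ t n / δ := Nat.floor_le h0
        have h2 : t n / δ < k n + 1 := Nat.lt_floor_add_one _
        rw [le_div_iff₀ hδ] at h1
        rw [div_lt_iff₀ hδ] at h2
        rw [abs_of_nonneg (by linarith)]
        linarith
    -- Link count, Cauchy–Schwarz weight and increment growth multiply to `2^{J-m}(6/5)^m(17/12)^m =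
    -- 2^J(17/20)^m`. The geometric sum is at most `20/3`, and `12 · 20/3 = 80`.
    · have hterm : ∀ m ∈ Finset.range J, ∫⁻ x, ENNReal.ofReal ((6 / 5) ^ m) *
          ∑ j ∈ Finset.range (2 ^ (J - m)),
          ‖F (2 ^ m * δ * (j : ℕ)) x - F (2 ^ m * δ * (2 * (j / 2) : ℕ)) x‖ₑ ^ 2
          ≤ ENNReal.ofReal (2 ^ J * (17 / 20) ^ m) * A := by
        intro m hm
        rw [lintegral_const_mul _ (Finset.measurable_sum _ fun j _ => hmeas _ _),
          lintegral_finsetSum _ fun j _ => hmeas _ _]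
        have hj : ∀ j ∈ Finset.range (2 ^ (J - m)),
            ∫⁻ x, ‖F (2 ^ m * δ * (j : ℕ)) x - F (2 ^ m * δ * (2 * (j / 2) : ℕ)) x‖ₑ ^ 2
              ≤ ENNReal.ofReal ((17 / 12) ^ m) * A := fun j _ => by
          refine hA m _ _ ?_
          rw [← mul_sub, abs_mul, abs_of_nonneg (by positivity : 0 ≤ 2 ^ m * δ)]
          refine mul_le_of_le_one_right (by positivity) ?_
          have h1 : (2 * (j / 2) : ℕ) ≤ j := Nat.mul_div_le j 2
          have h2 : j ≤ 2 * (j / 2) + 1 := by omega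
          have h1' : ((2 * (j / 2) : ℕ) : ℝ) ≤ j := by exact_mod_cast h1
          have h2' : (j : ℝ) ≤ (2 * (j / 2) : ℕ) + 1 := by exact_mod_cast h2
          rw [abs_of_nonneg (by linarith)]
          linarith
        refine (mul_le_mul_right (Finset.sum_le_card_nsmul _ _ _ hj) _).trans ?_
        rw [Finset.card_range, nsmul_eq_mul, ← mul_assoc, ← mul_assoc]
        gcongr
        have h2 : ((2 ^ (J - m) : ℕ) : ℝ≥0∞) = ENNReal.ofReal (2 ^ (J - m)) := by
          rw [ENNReal.ofReal_pow (by norm_num)]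
          norm_num
        rw [h2, ← ENNReal.ofReal_mul (by positivity), ← ENNReal.ofReal_mul (by positivity)]
        refine ENNReal.ofReal_le_ofReal (le_of_eq ?_)
        have hJ : (2 : ℝ) ^ J = 2 ^ (J - m) * 2 ^ m := by
          rw [← pow_add, Nat.sub_add_cancel (Finset.mem_range.1 hm).le]
        rw [hJ, mul_comm ((6 / 5 : ℝ) ^ m), mul_assoc, mul_assoc, ← mul_pow, ← mul_pow]
        norm_num
      refine (mul_le_mul_right (Finset.sum_le_sum hterm) _).trans ?_
      rw [← Finset.sum_mul, ← ENNReal.ofReal_sum_of_nonneg fun _ _ => by positivity,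
        ← Finset.mul_sum, ← mul_assoc]
      refine mul_le_mul_left ?_ _
      have hg : ∑ m ∈ Finset.range J, (17 / 20 : ℝ) ^ m ≤ 20 / 3 := by
        refine (geom_sum_le_inv_one_sub (by norm_num) (by norm_num) J).trans ?_
        norm_num
      have h80 : (80 * 2 ^ J : ℝ≥0∞) = ENNReal.ofReal (80 * 2 ^ J) := by
        rw [ENNReal.ofReal_mul (by norm_num), ENNReal.ofReal_pow (by norm_num)]
        norm_num
      have e12 : (12 : ℝ≥0∞) = ENNReal.ofReal 12 := by norm_num
      rw [h80, e12, ← ENNReal.ofReal_mul (by norm_num)]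
      refine ENNReal.ofReal_le_ofReal ?_
      have : (0 : ℝ) < 2 ^ J := by positivity
      nlinarith

/-! ### Summation over the dyadic time blocks. -/

/-- Summing over scales: the two geometric series meet where `q ^ l` is about `Y`. -/
theorem exists_tsum_min_le {q σ : ℝ} (hq : 1 < q) (hσ : 0 < σ) (hσ1 : σ < 1) :
    ∃ C : ℝ, 0 ≤ C ∧ ∀ Y : ℝ, 1 ≤ Y →
      ∑' l : ℕ, ENNReal.ofReal ((q ^ σ) ^ l * min 1 (Y * (q ^ l)⁻¹)) ≤
        ENNReal.ofReal (C * Y ^ σ) := by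
  have hq0 : 0 < q := by linarith
  set a := q ^ σ with ha_def
  have ha : 1 < a := Real.one_lt_rpow hq hσ
  have haq : a < q := by
    have := Real.rpow_lt_rpow_of_exponent_lt hq hσ1
    rwa [Real.rpow_one] at this
  have hρ0 : 0 ≤ a / q := by positivity
  have hρ : a / q < 1 := (div_lt_one hq0).2 haq
  refine ⟨a / (a - 1) + a * (1 - a / q)⁻¹,
    add_nonneg (div_nonneg (by linarith) (by linarith))
      (mul_nonneg (by linarith) (inv_nonneg.2 (by linarith))), fun Y hY => ?_⟩
  obtain ⟨L, hL1, hL2⟩ := exists_nat_pow_near hY hq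
  have haL : a ^ L ≤ Y ^ σ := by
    rw [ha_def, ← Real.rpow_natCast, ← Real.rpow_mul hq0.le, mul_comm, Real.rpow_mul hq0.le,
      Real.rpow_natCast]
    exact Real.rpow_le_rpow (by positivity) hL1 hσ.le
  rw [← Summable.sum_add_tsum_nat_add' (k := L + 1) ENNReal.summable, add_mul,
    ENNReal.ofReal_add (mul_nonneg (div_nonneg (by linarith) (by linarith)) (by positivity))
      (mul_nonneg (mul_nonneg (by linarith) (inv_nonneg.2 (by linarith))) (by positivity))]
  gcongr
  · rw [← ENNReal.ofReal_sum_of_nonneg fun l _ => by positivity]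
    refine ENNReal.ofReal_le_ofReal ?_
    have h1 : ∑ l ∈ Finset.range (L + 1), a ^ l * min 1 (Y * (q ^ l)⁻¹)
        ≤ ∑ l ∈ Finset.range (L + 1), a ^ l := by
      refine Finset.sum_le_sum fun l _ => mul_le_of_le_one_right (by positivity) (min_le_left _ _)
    refine h1.trans ?_
    rw [geom_sum_eq ha.ne', div_mul_eq_mul_div]
    have : 0 < a - 1 := by linarith
    gcongr
    rw [pow_succ]
    nlinarith
  · have hterm : ∀ l : ℕ, ENNReal.ofReal (a ^ (l + (L + 1)) * min 1 (Y * (q ^ (l + (L + 1)))⁻¹))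
        ≤ ENNReal.ofReal (a * Y ^ σ * (a / q) ^ l) := fun l => by
      refine ENNReal.ofReal_le_ofReal ?_
      calc a ^ (l + (L + 1)) * min 1 (Y * (q ^ (l + (L + 1)))⁻¹)
          ≤ a ^ (l + (L + 1)) * (Y * (q ^ (l + (L + 1)))⁻¹) := by
            gcongr
            exact min_le_right _ _
        _ = (a * a ^ L) * (a / q) ^ l * (Y * (q ^ (L + 1))⁻¹) := by
            rw [div_pow]
            field_simp
            ring
        _ ≤ (a * Y ^ σ) * (a / q) ^ l * 1 := by
            gcongr
            rw [← div_eq_mul_inv, div_le_one (by positivity)]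
            exact hL2.le
        _ = _ := mul_one _
    refine (ENNReal.tsum_le_tsum hterm).trans ?_
    rw [← ENNReal.ofReal_tsum_of_nonneg (fun l => by positivity)
      ((summable_geometric_of_lt_one hρ0 hρ).mul_left _), tsum_mul_left,
      tsum_geometric_of_lt_one hρ0 hρ]
    refine ENNReal.ofReal_le_ofReal (le_of_eq ?_)
    ring

/-- The exponent `r = s/(1-s)` is decided here. With `q = 2^{(1+r)/2}` the terms are comparable to
`2^{rl} min(1, |η| q^{-l})`, and `(1+r)s = r` says `2^r = q^{2s}`, so the sum is of size `|η|^{2s}`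
at high frequency. Summability of the tail is `2s < 1`. -/
theorem exists_tsum_scales_le {s : ℝ} (hs : 0 < s) (hs' : s < 1 / 2) (J : ℕ → ℕ)
    (hJ : ∀ l, J l = ⌈(l : ℝ) * (s / (1 - s))⌉₊) :
    ∃ C : ℝ, 0 ≤ C ∧ ∀ η : Plane,
      ∑' l : ℕ, 2 ^ J l *
        ENNReal.ofReal (4 * min 1 (√((2 ^ (l + J l))⁻¹) * (2 * Real.pi * ‖η‖))) ≤
        ENNReal.ofReal (C * (1 + ‖η‖ ^ 2) ^ s) := by
  set r := s / (1 - s) with hr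
  have h1s : 0 < 1 - s := by linarith
  have hr0 : 0 < r := div_pos hs h1s
  have hrs : (1 + r) * s = r := by
    rw [hr]
    field_simp
    ring
  set q : ℝ := 2 ^ ((1 + r) / 2) with hq
  have hq1 : 1 < q := Real.one_lt_rpow (by norm_num) (by linarith)
  obtain ⟨C, hC0, hC⟩ := exists_tsum_min_le hq1 (σ := 2 * s) (by linarith) (by linarith)
  refine ⟨8 * (C * (2 * Real.pi) ^ (2 * s)), by positivity, fun η => ?_⟩
  set Y : ℝ := 2 * Real.pi * √(1 + ‖η‖ ^ 2) with hY
  have hsq1 : 1 ≤ √(1 + ‖η‖ ^ 2) := by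
    rw [Real.one_le_sqrt]
    nlinarith [sq_nonneg ‖η‖]
  have hpi : 1 ≤ 2 * Real.pi := by linarith [Real.pi_gt_three]
  have hY1 : 1 ≤ Y := one_le_mul_of_one_le_of_one_le hpi hsq1
  have hYs : Y ^ (2 * s) = (2 * Real.pi) ^ (2 * s) * (1 + ‖η‖ ^ 2) ^ s := by
    rw [hY, Real.mul_rpow (by positivity) (by positivity), Real.sqrt_eq_rpow,
      ← Real.rpow_mul (by positivity)]
    congr 2
    ring
  have hqs : q ^ (2 * s) = 2 ^ r := by
    rw [hq, ← Real.rpow_mul (by norm_num)]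
    congr 1
    linarith
  have hterm : ∀ l : ℕ, 2 ^ J l *
        ENNReal.ofReal (4 * min 1 (√((2 ^ (l + J l))⁻¹) * (2 * Real.pi * ‖η‖)))
      ≤ ENNReal.ofReal 8 *
        ENNReal.ofReal ((q ^ (2 * s)) ^ l * min 1 (Y * (q ^ l)⁻¹)) := fun l => by
    have e : (2 ^ J l : ℝ≥0∞) = ENNReal.ofReal (2 ^ J l) := by
      rw [ENNReal.ofReal_pow (by norm_num)]
      norm_num
    rw [e, ← ENNReal.ofReal_mul (by positivity), ← ENNReal.ofReal_mul (by norm_num)]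
    refine ENNReal.ofReal_le_ofReal ?_
    have hlr : 0 ≤ (l : ℝ) * r := by positivity
    have hJ1 : (l : ℝ) * r ≤ J l := by
      rw [hJ]
      exact Nat.le_ceil _
    have hJ2 : (J l : ℝ) ≤ l * r + 1 := by
      rw [hJ]
      exact (Nat.ceil_lt_add_one hlr).le
    have h1 : (2 : ℝ) ^ J l ≤ 2 * (q ^ (2 * s)) ^ l := by
      rw [hqs, ← Real.rpow_natCast, ← Real.rpow_natCast, ← Real.rpow_mul (by norm_num)]
      calc (2 : ℝ) ^ (J l : ℝ) ≤ 2 ^ (r * l + 1) :=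
            Real.rpow_le_rpow_of_exponent_le (by norm_num) (by linarith)
        _ = _ := by rw [Real.rpow_add (by norm_num), Real.rpow_one, mul_comm]
    have h2 : √((2 ^ (l + J l))⁻¹) ≤ (q ^ l)⁻¹ := by
      rw [Real.sqrt_inv]
      gcongr
      refine Real.le_sqrt_of_sq_le ?_
      rw [← Real.rpow_natCast 2 (l + J l), hq, ← Real.rpow_natCast, ← Real.rpow_natCast,
        ← Real.rpow_mul (by positivity), ← Real.rpow_mul (by norm_num)]
      refine Real.rpow_le_rpow_of_exponent_le (by norm_num) ?_
      push_cast
      linarith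
    have h3 : ‖η‖ ≤ √(1 + ‖η‖ ^ 2) := Real.le_sqrt_of_sq_le (by linarith)
    calc (2 : ℝ) ^ J l * (4 * min 1 (√((2 ^ (l + J l))⁻¹) * (2 * Real.pi * ‖η‖)))
        ≤ (2 * (q ^ (2 * s)) ^ l) * (4 * min 1 ((q ^ l)⁻¹ * (2 * Real.pi * √(1 + ‖η‖ ^ 2)))) := by
          gcongr
      _ = _ := by
          rw [hY, mul_comm (2 * Real.pi * √(1 + ‖η‖ ^ 2))]
          ring
  refine (ENNReal.tsum_le_tsum hterm).trans ?_
  rw [ENNReal.tsum_mul_left]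
  refine (mul_le_mul_right (hC Y hY1) _).trans ?_
  rw [← ENNReal.ofReal_mul (by norm_num), hYs]
  refine ENNReal.ofReal_le_ofReal (le_of_eq ?_)
  ring

theorem tsum_incrementBound_lt_top {s : ℝ} (hs : 0 < s) (hs' : s < 1 / 2) (J : ℕ → ℕ)
    (hJ : ∀ l, J l = ⌈(l : ℝ) * (s / (1 - s))⌉₊) {f : Lp ℂ 2 (volume : Measure Plane)}
    (hf : TemperedDistribution.MemSobolev s 2 (f : 𝓢'(Plane, ℂ))) :
    ∑' l : ℕ, 2 ^ J l * incrementBound f ((2 ^ (l + J l))⁻¹) < ∞ := by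
  obtain ⟨C, hC0, hC⟩ := exists_tsum_scales_le hs hs' J hJ
  obtain ⟨g, hg⟩ := (memSobolev_iff_exists_fourier_eq_besselMul hs.le f).1 hf
  have hmeasF : AEMeasurable (fun η => ‖(𝓕 f : Lp ℂ 2 (volume : Measure Plane)) η‖ₑ ^ 2) volume :=
    ((Lp.stronglyMeasurable _).measurable.enorm.pow_const 2).aemeasurable
  have hmeas : ∀ l, AEMeasurable (fun η : Plane => 2 ^ J l *
      (ENNReal.ofReal (4 * min 1 (√((2 ^ (l + J l))⁻¹) * (2 * Real.pi * ‖η‖))) *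
        ‖(𝓕 f : Lp ℂ 2 (volume : Measure Plane)) η‖ₑ ^ 2)) volume := fun l => by
    refine AEMeasurable.const_mul (AEMeasurable.mul ?_ hmeasF) _
    exact (by fun_prop : Measurable fun η : Plane =>
      ENNReal.ofReal (4 * min 1 (√((2 ^ (l + J l))⁻¹) * (2 * Real.pi * ‖η‖)))).aemeasurable
  have e : ∀ l, 2 ^ J l * incrementBound f ((2 ^ (l + J l))⁻¹) = ∫⁻ η : Plane, 2 ^ J l *
      (ENNReal.ofReal (4 * min 1 (√((2 ^ (l + J l))⁻¹) * (2 * Real.pi * ‖η‖))) *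
        ‖(𝓕 f : Lp ℂ 2 (volume : Measure Plane)) η‖ₑ ^ 2) := fun l => by
    rw [incrementBound, lintegral_const_mul' _ _ (by finiteness)]
  simp_rw [e]
  rw [← lintegral_tsum hmeas]
  calc _ ≤ ∫⁻ η, ENNReal.ofReal C * ‖g η‖ₑ ^ 2 := by
        refine lintegral_mono_ae ?_
        filter_upwards [coeFn_besselMul hs.le g] with η hη
        have e' : ∀ l, 2 ^ J l *
            (ENNReal.ofReal (4 * min 1 (√((2 ^ (l + J l))⁻¹) * (2 * Real.pi * ‖η‖))) *
              ‖(𝓕 f : Lp ℂ 2 (volume : Measure Plane)) η‖ₑ ^ 2) = 2 ^ J l *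
            ENNReal.ofReal (4 * min 1 (√((2 ^ (l + J l))⁻¹) * (2 * Real.pi * ‖η‖))) *
              ‖(𝓕 f : Lp ℂ 2 (volume : Measure Plane)) η‖ₑ ^ 2 := fun l => (mul_assoc _ _ _).symm
        simp_rw [e']
        rw [ENNReal.tsum_mul_right, hg, hη]
        refine (mul_le_mul_left (hC η) _).trans ?_
        rw [enorm_mul, mul_pow, ← mul_assoc]
        refine mul_le_mul_left (le_of_eq ?_) _
        rw [← ofReal_norm, ← ENNReal.ofReal_pow (norm_nonneg _), norm_besselWeight_sq,
          ← ENNReal.ofReal_mul (by positivity), mul_assoc, ← Real.rpow_add (by positivity),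
          add_neg_cancel, Real.rpow_zero, mul_one]
    _ < ∞ := by
        rw [lintegral_const_mul' _ _ (by finiteness), ← Lp.enorm_sq_eq_lintegral]
        finiteness

/-! ### Convergence under the weak Lorentz condition. -/

theorem finite_setOf_le {t : ℕ → ℝ} (ht_lim : Tendsto t atTop (𝓝 0)) {c : ℝ} (hc : 0 < c) :
    {n | c ≤ t n}.Finite := by
  have := ht_lim.eventually (gt_mem_nhds hc)
  rw [← Nat.cofinite_eq_atTop, eventually_cofinite] at this
  simpa using this

theorem tendsto_boxMean_of_memWeakLorentz {s : ℝ} (hs : 0 < s) (hs' : s < 1 / 2) {t : ℕ → ℝ}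
    (ht_mem : ∀ n, t n ∈ Set.Ioo (0 : ℝ) 1) (ht_lim : Tendsto t atTop (𝓝 0))
    (hw : MemWeakLorentz (s / (1 - s)) t) {f : Lp ℂ 2 (volume : Measure Plane)}
    (hf : TemperedDistribution.MemSobolev s 2 (f : 𝓢'(Plane, ℂ))) :
    ∀ᵐ x : Plane, Tendsto (fun n => boxMean (t n) f x) atTop (𝓝 (f x)) := by
  set r := s / (1 - s) with hr
  have hr0 : 0 < r := div_pos hs (by linarith)
  set J : ℕ → ℕ := fun l => ⌈(l : ℝ) * r⌉₊ with hJ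
  set K : ℝ≥0∞ := ⨆ b : Set.Ioi (0 : ℝ),
    ENNReal.ofReal ((b : ℝ) ^ r) * (Set.encard {n | (b : ℝ) < t n} : ℝ≥0∞) with hK
  have hK' : K < ∞ := hw
  -- The blocks `[2^{-(l+2)}, 2^{-l})` overlap, so that the half-open dyadic interval found for `t
  -- n` below fits inside one despite the strict upper end.
  set I : ℕ → Finset ℕ := fun l =>
    ((finite_setOf_le ht_lim (c := (2 ^ (l + 2))⁻¹) (by positivity)).toFinset).filter
      fun n => t n < (2 ^ l)⁻¹ with hI
  have hcard : ∀ l, ((I l).card : ℝ≥0∞) ≤ K * ENNReal.ofReal (8 ^ r) * 2 ^ J l := fun l => by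
    -- One scale below the block, since the weak norm counts strict inequalities. The extra factor
    -- `2^{-3}` costs the constant `8 ^ r`.
    have hb : (0 : ℝ) < (2 ^ (l + 3))⁻¹ := by positivity
    have h1 := le_iSup (fun b : Set.Ioi (0 : ℝ) =>
      ENNReal.ofReal ((b : ℝ) ^ r) * (Set.encard {n | (b : ℝ) < t n} : ℝ≥0∞))
      ⟨(2 ^ (l + 3))⁻¹, hb⟩
    rw [← hK] at h1
    have h2 : ((I l).card : ℝ≥0∞) ≤ (Set.encard {n | ((2 ^ (l + 3))⁻¹ : ℝ) < t n} : ℝ≥0∞) := by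
      have : ((I l : Set ℕ).encard : ℝ≥0∞) ≤
          (Set.encard {n | ((2 ^ (l + 3))⁻¹ : ℝ) < t n} : ℝ≥0∞) := by
        refine ENat.toENNReal_mono (Set.encard_le_encard fun n hn => ?_)
        have hn' : (2 ^ (l + 2))⁻¹ ≤ t n := by
          have := Finset.mem_coe.1 hn
          simp only [hI, Finset.mem_filter, Set.Finite.mem_toFinset, Set.mem_ofPred_eq] at this
          exact this.1
        refine lt_of_lt_of_le ?_ hn'
        gcongr
        · norm_num
        · norm_num
      rwa [Set.encard_coe_eq_coe_finsetCard] at this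
    have h3 : (1 : ℝ≥0∞) ≤ ENNReal.ofReal (8 ^ r) * 2 ^ J l *
        ENNReal.ofReal (((2 ^ (l + 3))⁻¹ : ℝ) ^ r) := by
      have e : (2 ^ J l : ℝ≥0∞) = ENNReal.ofReal (2 ^ J l) := by
        rw [ENNReal.ofReal_pow (by norm_num)]
        norm_num
      rw [e, ← ENNReal.ofReal_mul (by positivity), ← ENNReal.ofReal_mul (by positivity),
        ENNReal.one_le_ofReal]
      have h4 : (2 : ℝ) ^ ((l : ℝ) * r) ≤ 2 ^ J l := by
        rw [← Real.rpow_natCast]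
        exact Real.rpow_le_rpow_of_exponent_le (by norm_num) (Nat.le_ceil _)
      have h5 : (8 : ℝ) ^ r * 2 ^ ((l : ℝ) * r) * ((2 ^ (l + 3))⁻¹ : ℝ) ^ r = 1 := by
        rw [Real.rpow_mul (by norm_num), ← Real.mul_rpow (by norm_num) (by positivity),
          ← Real.mul_rpow (by positivity) (by positivity), Real.rpow_natCast, pow_add]
        have : (8 : ℝ) * 2 ^ l * (2 ^ l * 2 ^ 3)⁻¹ = 1 := by
          field_simp
          norm_num
        rw [this, Real.one_rpow]
      rw [← h5]
      gcongr
    calc ((I l).card : ℝ≥0∞) = 1 * (I l).card := (one_mul _).symm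
      _ ≤ (ENNReal.ofReal (8 ^ r) * 2 ^ J l * ENNReal.ofReal (((2 ^ (l + 3))⁻¹ : ℝ) ^ r)) *
          (Set.encard {n | ((2 ^ (l + 3))⁻¹ : ℝ) < t n} : ℝ≥0∞) := mul_le_mul' h3 h2
      _ ≤ ENNReal.ofReal (8 ^ r) * 2 ^ J l * K := by
          rw [mul_assoc]
          exact mul_le_mul_right h1 _
      _ = _ := by ring
  have hblock : ∀ l, ∃ B : Plane → ℝ≥0∞, Measurable B ∧
      (∀ x, ∀ n ∈ I l, ‖boxMean (t n) f x - boxMean 0 f x‖ₑ ^ 2 ≤ B x) ∧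
      ∫⁻ x, B x ≤ (2 * ((I l).card : ℝ≥0∞) + 80 * 2 ^ J l) *
        incrementBound f ((2 ^ (l + J l))⁻¹) := fun l => by
    refine exists_chaining_bound (F := fun t => boxMean t f) (δ := (2 ^ (l + J l))⁻¹)
      (fun t => (Lp.stronglyMeasurable _).measurable) (by positivity) (J l) ?_ (I l) t ?_
    · intro m a b hab
      exact (lintegral_boxMean_sub_sq_le hab f).trans (incrementBound_two_pow_mul f _ m)
    · intro n hn
      simp only [hI, Finset.mem_filter] at hn
      refine ⟨(ht_mem n).1.le, hn.2.trans_eq ?_⟩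
      rw [pow_add]
      field_simp
  choose B hBm hB hBint using hblock
  have hsum : ∑' l, ∫⁻ x, B l x < ∞ := by
    have hle : ∀ l, ∫⁻ x, B l x ≤ (2 * (K * ENNReal.ofReal (8 ^ r)) + 80) *
        (2 ^ J l * incrementBound f ((2 ^ (l + J l))⁻¹)) := fun l => by
      refine (hBint l).trans ?_
      rw [← mul_assoc]
      refine mul_le_mul_left ?_ _
      rw [add_mul, mul_assoc]
      exact add_le_add (mul_le_mul_right (hcard l) _) le_rfl
    refine (ENNReal.tsum_le_tsum hle).trans_lt ?_
    rw [ENNReal.tsum_mul_left]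
    exact ENNReal.mul_lt_top
      (ENNReal.add_lt_top.2 ⟨ENNReal.mul_lt_top (by simp)
        (ENNReal.mul_lt_top hK' ENNReal.ofReal_lt_top), by simp⟩)
      (tsum_incrementBound_lt_top hs hs' J (fun l => rfl) hf)
  rw [← lintegral_tsum fun l => (hBm l).aemeasurable] at hsum
  filter_upwards [ae_lt_top (Measurable.tsum hBm) hsum.ne] with x hx
  have hB0 := ENNReal.tendsto_atTop_zero_of_tsum_ne_top hx.ne
  rw [EMetric.tendsto_atTop]
  intro ε hε
  have hε2 : 0 < ε ^ 2 := by positivity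
  obtain ⟨L, hL⟩ := eventually_atTop.1 (hB0.eventually (gt_mem_nhds hε2))
  obtain ⟨N, hN⟩ := eventually_atTop.1
    (ht_lim.eventually (gt_mem_nhds (by positivity : (0 : ℝ) < 2⁻¹ ^ (L + 1))))
  refine ⟨N, fun n hn => ?_⟩
  obtain ⟨k, hk1, hk2⟩ := exists_nat_pow_near_of_lt_one (ht_mem n).1 (ht_mem n).2.le
    (by norm_num : (0 : ℝ) < 2⁻¹) (by norm_num)
  have hLk : L + 1 < k + 1 :=
    (pow_lt_pow_iff_right_of_lt_one₀ (by norm_num) (by norm_num)).1 (hk1.trans (hN n hn))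
  obtain ⟨l, rfl⟩ : ∃ l, k = l + 1 := ⟨k - 1, by omega⟩
  have hnI : n ∈ I l := by
    simp only [hI, Finset.mem_filter, Set.Finite.mem_toFinset, Set.mem_ofPred_eq, ← inv_pow]
    refine ⟨hk1.le, hk2.trans_lt ?_⟩
    exact pow_lt_pow_right_of_lt_one₀ (by norm_num) (by norm_num) (Nat.lt_succ_self l)
  have h1 := (hB l x n hnI).trans_lt (hL l (by omega))
  rw [boxMean_zero] at h1
  rw [edist_eq_enorm_sub]
  exact lt_of_pow_lt_pow_left' 2 h1

/-! ### Banach's principle by Baire category. -/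

theorem lintegral_enorm_restrict_le {Q : Set Plane} (u : Lp ℂ 2 (volume : Measure Plane)) :
    ∫⁻ x in Q, ‖u x‖ₑ ≤ ‖u‖ₑ * volume Q ^ (1 / 2 : ℝ) := by
  have h := eLpNorm_le_eLpNorm_mul_rpow_measure_univ (p := 1) (q := 2) (μ := volume.restrict Q)
    (f := u) (by norm_num) (Lp.aestronglyMeasurable u).restrict
  rw [eLpNorm_one_eq_lintegral_enorm, Measure.restrict_apply_univ] at h
  refine h.trans ?_
  have h2 : (1 / (1 : ℝ≥0∞).toReal - 1 / (2 : ℝ≥0∞).toReal) = (1 / 2 : ℝ) := by norm_num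
  rw [h2, Lp.enorm_def]
  gcongr
  exact Measure.restrict_le_self

theorem min_one_add_le (a b : ℝ≥0∞) : min 1 (a + b) ≤ min 1 a + min 1 b := by
  rcases le_total 1 a with h | h
  · rw [min_eq_left h]
    exact (min_le_left _ _).trans le_self_add
  · rcases le_total 1 b with h' | h'
    · rw [min_eq_left h']
      exact (min_le_left _ _).trans le_add_self
    · rw [min_eq_right h, min_eq_right h']
      exact min_le_right _ _

/-- The truncated maximal functional of finitely many of the operators `T n` on the set `Q`. -/
noncomputable def maxFunctional (Q : Set Plane)
    (T : ℕ → Lp ℂ 2 (volume : Measure Plane) → Lp ℂ 2 (volume : Measure Plane)) (C N : ℕ)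
    (g : Lp ℂ 2 (volume : Measure Plane)) : ℝ≥0∞ :=
  ∫⁻ x in Q, min 1 ((C : ℝ≥0∞)⁻¹ * (Finset.range N).sup fun n => ‖T n g x‖ₑ)

section BanachPrinciple

variable {Q : Set Plane}
  {T : ℕ → Lp ℂ 2 (volume : Measure Plane) → Lp ℂ 2 (volume : Measure Plane)}

theorem measurable_sup_enorm (N : ℕ) (g : Lp ℂ 2 (volume : Measure Plane)) :
    Measurable fun x => (Finset.range N).sup fun n => ‖T n g x‖ₑ := by
  simp_rw [Finset.sup_eq_iSup]
  exact Measurable.iSup fun n => Measurable.iSup fun _ =>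
    (Lp.stronglyMeasurable _).measurable.enorm

theorem ae_sup_enorm_le (hsub : ∀ n g h, T n (g - h) = T n g - T n h) (N : ℕ)
    (g h : Lp ℂ 2 (volume : Measure Plane)) :
    ∀ᵐ x : Plane, ((Finset.range N).sup fun n => ‖T n g x‖ₑ) ≤
      ((Finset.range N).sup fun n => ‖T n h x‖ₑ) +
        (Finset.range N).sup fun n => ‖T n (g - h) x‖ₑ := by
  have h1 : ∀ᵐ x : Plane, ∀ n, T n (g - h) x = T n g x - T n h x := by
    refine ae_all_iff.2 fun n => ?_
    rw [hsub]
    filter_upwards [Lp.coeFn_sub (T n g) (T n h)] with x hx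
    rw [hx, Pi.sub_apply]
  filter_upwards [h1] with x hx
  refine Finset.sup_le fun n hn => ?_
  calc ‖T n g x‖ₑ = ‖T n h x + T n (g - h) x‖ₑ := by rw [hx, add_sub_cancel]
    _ ≤ ‖T n h x‖ₑ + ‖T n (g - h) x‖ₑ := enorm_add_le _ _
    _ ≤ _ := add_le_add (Finset.le_sup (f := fun n => ‖T n h x‖ₑ) hn)
      (Finset.le_sup (f := fun n => ‖T n (g - h) x‖ₑ) hn)

theorem maxFunctional_le_add (hsub : ∀ n g h, T n (g - h) = T n g - T n h) (C N : ℕ)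
    (g h : Lp ℂ 2 (volume : Measure Plane)) :
    maxFunctional Q T C N g ≤ maxFunctional Q T C N h + maxFunctional Q T C N (g - h) := by
  unfold maxFunctional
  rw [← lintegral_add_left (measurable_const.min ((measurable_sup_enorm N h).const_mul _))]
  refine lintegral_mono_ae (ae_restrict_of_ae ?_)
  filter_upwards [ae_sup_enorm_le hsub N g h] with x hx
  refine (min_le_min_left 1 (mul_le_mul_right hx _)).trans ?_
  rw [mul_add]
  exact min_one_add_le _ _

/-- A crude bound growing with `N`. It serves only for the continuity of each finite stage, which
makes the Baire sets closed. -/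
theorem maxFunctional_le_norm (hnorm : ∀ n g, ‖T n g‖ ≤ ‖g‖) (C N : ℕ)
    (g : Lp ℂ 2 (volume : Measure Plane)) :
    maxFunctional Q T C N g ≤ (C : ℝ≥0∞)⁻¹ * (N * (‖g‖ₑ * volume Q ^ (1 / 2 : ℝ))) := by
  unfold maxFunctional
  calc _ ≤ ∫⁻ x in Q, (C : ℝ≥0∞)⁻¹ * ∑ n ∈ Finset.range N, ‖T n g x‖ₑ := by
        refine lintegral_mono fun x => (min_le_right _ _).trans (mul_le_mul_right ?_ _)
        exact Finset.sup_le fun n hn =>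
          Finset.single_le_sum (f := fun n => ‖T n g x‖ₑ) (fun _ _ => zero_le) hn
    _ = (C : ℝ≥0∞)⁻¹ * ∑ n ∈ Finset.range N, ∫⁻ x in Q, ‖T n g x‖ₑ := by
        have hm : ∀ n ∈ Finset.range N, Measurable fun x => ‖T n g x‖ₑ := fun _ _ =>
          (Lp.stronglyMeasurable _).measurable.enorm
        rw [lintegral_const_mul _ (Finset.measurable_fun_sum _ hm), lintegral_finsetSum _ hm]
    _ ≤ _ := by
        refine mul_le_mul_right ((Finset.sum_le_card_nsmul _ _ (‖g‖ₑ * volume Q ^ (1 / 2 : ℝ))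
          fun n _ => (lintegral_enorm_restrict_le _).trans ?_).trans ?_) _
        · refine mul_le_mul_left ?_ _
          rw [← ofReal_norm, ← ofReal_norm]
          exact ENNReal.ofReal_le_ofReal (hnorm n g)
        · rw [Finset.card_range, nsmul_eq_mul]

theorem isClosed_setOf_maxFunctional_le (hQ : volume Q ≠ ∞)
    (hsub : ∀ n g h, T n (g - h) = T n g - T n h)
    (hnorm : ∀ n g, ‖T n g‖ ≤ ‖g‖) {C : ℕ} (hC : C ≠ 0) (N : ℕ) (ε : ℝ≥0∞) :
    IsClosed {g | maxFunctional Q T C N g ≤ ε} := by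
  refine IsSeqClosed.isClosed fun h g hh hlim => ?_
  have h0 : Tendsto (fun k => ‖g - h k‖ₑ) atTop (𝓝 0) := by
    have h1 : Tendsto (fun k => g - h k) atTop (𝓝 (g - g)) := tendsto_const_nhds.sub hlim
    rw [sub_self] at h1
    simpa using h1.enorm
  have hc : (C : ℝ≥0∞)⁻¹ ≠ ∞ := by simpa using hC
  have hlim2 : Tendsto (fun k => ε + (C : ℝ≥0∞)⁻¹ * (N * (‖g - h k‖ₑ * volume Q ^ (1 / 2 : ℝ))))
      atTop (𝓝 (ε + (C : ℝ≥0∞)⁻¹ * (N * (0 * volume Q ^ (1 / 2 : ℝ))))) := by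
    refine tendsto_const_nhds.add (ENNReal.Tendsto.const_mul (ENNReal.Tendsto.const_mul
      (ENNReal.Tendsto.mul_const h0 (Or.inr ?_)) (Or.inr (ENNReal.natCast_ne_top N))) (Or.inr hc))
    exact ENNReal.rpow_ne_top_of_nonneg (by norm_num) hQ
  rw [zero_mul, mul_zero, mul_zero, add_zero] at hlim2
  refine ge_of_tendsto' hlim2 fun k => ?_
  exact (maxFunctional_le_add hsub C N g (h k)).trans
    (add_le_add (hh k) (maxFunctional_le_norm hnorm C N _))

/-- Dominated convergence as `C → ∞`: the truncation at 1 supplies the dominating function on the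
finite-measure set `Q`. -/
theorem exists_maxFunctional_le (hQ : volume Q ≠ ∞) (g : Lp ℂ 2 (volume : Measure Plane))
    (hbdd : ∀ᵐ x : Plane, ⨆ n, ‖T n g x‖ₑ < ∞) {ε : ℝ≥0∞} (hε : ε ≠ 0) :
    ∃ C : ℕ, ∀ N, maxFunctional Q T (C + 1) N g ≤ ε := by
  have hm : Measurable fun x => ⨆ n, ‖T n g x‖ₑ :=
    Measurable.iSup fun _ => (Lp.stronglyMeasurable _).measurable.enorm
  have hlim : Tendsto (fun C : ℕ => ∫⁻ x in Q, min 1 (((C + 1 : ℕ) : ℝ≥0∞)⁻¹ * ⨆ n, ‖T n g x‖ₑ))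
      atTop (𝓝 (∫⁻ x in Q, 0)) := by
    refine tendsto_lintegral_of_dominated_convergence (fun _ => 1)
      (fun C => measurable_const.min (hm.const_mul _))
      (fun C => ae_of_all _ fun x => min_le_left _ _) (by simpa using hQ)
      (ae_restrict_of_ae ?_)
    filter_upwards [hbdd] with x hx
    have h1 : Tendsto (fun C : ℕ => ((C + 1 : ℕ) : ℝ≥0∞)⁻¹ * ⨆ n, ‖T n g x‖ₑ) atTop
        (𝓝 (0 * ⨆ n, ‖T n g x‖ₑ)) :=
      ENNReal.Tendsto.mul_const
        (ENNReal.tendsto_inv_nat_nhds_zero.comp (tendsto_add_atTop_nat 1)) (Or.inr hx.ne)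
    rw [zero_mul] at h1
    have h2 := (tendsto_const_nhds (x := (1 : ℝ≥0∞))).min h1
    simpa using h2
  rw [lintegral_zero] at hlim
  obtain ⟨C, hC⟩ := (hlim.eventually (ge_mem_nhds (pos_iff_ne_zero.2 hε))).exists
  refine ⟨C, fun N => le_trans (lintegral_mono fun x => ?_) hC⟩
  refine min_le_min_left 1 (mul_le_mul_right ?_ _)
  exact Finset.sup_le fun n _ => le_iSup (fun n => ‖T n g x‖ₑ) n

/-- Banach's principle: almost everywhere finiteness of the maximal function is uniform near `0`. -/
theorem exists_uniform_maxFunctional_le (hQ : volume Q ≠ ∞)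
    (hsub : ∀ n g h, T n (g - h) = T n g - T n h) (hnorm : ∀ n g, ‖T n g‖ ≤ ‖g‖)
    (hbdd : ∀ g, ∀ᵐ x : Plane, ⨆ n, ‖T n g x‖ₑ < ∞) {ε : ℝ≥0∞} (hε : ε ≠ 0) :
    ∃ ρ > 0, ∃ C : ℕ, C ≠ 0 ∧ ∀ g, ‖g‖ < ρ → ∀ N, maxFunctional Q T C N g ≤ 2 * ε := by
  -- These closed sets cover `L²`, so one of them contains a ball around some `g₀`.
  obtain ⟨C, g₀, hg₀⟩ := nonempty_interior_of_iUnion_of_closed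
    (f := fun C : ℕ => ⋂ N, {g | maxFunctional Q T (C + 1) N g ≤ ε})
    (fun C => isClosed_iInter fun N =>
      isClosed_setOf_maxFunctional_le hQ hsub hnorm C.succ_ne_zero N ε)
    (Set.eq_univ_of_forall fun g => Set.mem_iUnion.2 <|
      (exists_maxFunctional_le hQ g (hbdd g) hε).imp fun C hC => Set.mem_iInter.2 hC)
  obtain ⟨ρ, hρ, hball⟩ := Metric.isOpen_iff.1 isOpen_interior g₀ hg₀
  have hmem : ∀ h, ‖h - g₀‖ < ρ → ∀ N, maxFunctional Q T (C + 1) N h ≤ ε := fun h hh N =>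
    Set.mem_iInter.1 (interior_subset (hball (by rwa [Metric.mem_ball, dist_eq_norm]))) N
  refine ⟨ρ, hρ, C + 1, C.succ_ne_zero, fun g hg N => ?_⟩
  -- The ball is moved to the origin by `g = (g + g₀) - g₀`. Both parts lie in it, at the price of
  -- doubling `ε`.
  have h1 := maxFunctional_le_add (Q := Q) hsub (C + 1) N g (g + g₀)
  have h2 : g - (g + g₀) = 0 - g₀ := by abel
  have h3 := hmem (g + g₀) (by simpa using hg) N
  have hneg : ∀ n, T n (0 - g₀) = -T n g₀ := fun n => by
    rw [hsub, ← sub_self g₀, hsub, sub_self, zero_sub]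
  have h4 : maxFunctional Q T (C + 1) N (0 - g₀) = maxFunctional Q T (C + 1) N g₀ := by
    unfold maxFunctional
    refine lintegral_congr_ae (ae_restrict_of_ae ?_)
    have : ∀ᵐ x : Plane, ∀ n, T n (0 - g₀) x = -T n g₀ x := by
      refine ae_all_iff.2 fun n => ?_
      rw [hneg]
      filter_upwards [Lp.coeFn_neg (T n g₀)] with x hx
      rw [hx, Pi.neg_apply]
    filter_upwards [this] with x hx
    simp only [hx, enorm_neg]
  rw [h2, h4] at h1
  refine h1.trans ?_
  rw [two_mul]
  exact add_le_add h3 (hmem g₀ (by simpa using hρ) N)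

end BanachPrinciple

/-! ### Dense times when the weak Lorentz condition fails. -/

theorem exists_lt_iff {t : ℕ → ℝ} (ht_anti : Antitone t) (ht_lim : Tendsto t atTop (𝓝 0)) {c : ℝ}
    (hc : 0 < c) : ∃ d : ℕ, ∀ n, c < t n ↔ n < d := by
  classical
  have hex : ∃ n, t n ≤ c := ((ht_lim.eventually (ge_mem_nhds hc))).exists
  refine ⟨Nat.find hex, fun n => ⟨fun h => ?_, fun h => not_le.1 (Nat.find_min hex h)⟩⟩
  by_contra! hn
  exact absurd ((ht_anti hn).trans (Nat.find_spec hex)) (not_le.2 h)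

/-- The distance on the right is made of `k` gaps, none smaller than the gap that follows them. -/
theorem mul_gap_le {t : ℕ → ℝ} (ht_gap : Antitone fun n => t n - t (n + 1)) (p k : ℕ) :
    k * (t (p + k) - t (p + k + 1)) ≤ t p - t (p + k) := by
  induction k with
  | zero => simp
  | succ k ih =>
    have h1 := ht_gap (Nat.le_succ (p + k))
    simp only [Nat.succ_eq_add_one] at h1
    have h2 : (0 : ℝ) ≤ k + 1 := by positivity
    push_cast
    rw [← add_assoc]
    nlinarith [mul_le_mul_of_nonneg_left h1 h2]

/-- If every dyadic block is under control, so is the whole counting function. -/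
theorem counting_le_of_block_le {r M b₀ : ℝ} (hr : 0 < r) (hM : 0 ≤ M) (hb₀ : 0 < b₀) {D : ℝ → ℕ}
    (hD : ∀ b c, 0 < b → b ≤ c → D c ≤ D b)
    (hblock : ∀ b, 0 < b → b < b₀ → (D b : ℝ) ≤ D (2 * b) + M * b ^ (-r)) {b : ℝ} (hb : 0 < b) :
    (D b : ℝ) ≤ M / (1 - 2 ^ (-r)) * b ^ (-r) + D b₀ := by
  have h2r : (2 : ℝ) ^ (-r) < 1 := Real.rpow_lt_one_of_one_lt_of_neg (by norm_num) (by linarith)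
  have hC : 0 ≤ M / (1 - 2 ^ (-r)) := div_nonneg hM (by linarith)
  have key : ∀ i : ℕ, ∀ b, 0 < b → b₀ ≤ 2 ^ i * b →
      (D b : ℝ) ≤ M / (1 - 2 ^ (-r)) * b ^ (-r) + D b₀ := by
    intro i
    induction i with
    | zero =>
      intro b hb h
      have h1 : (D b : ℝ) ≤ D b₀ := by exact_mod_cast hD b₀ b hb₀ (by simpa using h)
      have h2 : 0 ≤ M / (1 - 2 ^ (-r)) * b ^ (-r) := by positivity
      linarith
    | succ i ih =>
      intro b hb h
      rcases le_or_gt b₀ b with h' | h'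
      · have h1 : (D b : ℝ) ≤ D b₀ := by exact_mod_cast hD b₀ b hb₀ h'
        have h2 : 0 ≤ M / (1 - 2 ^ (-r)) * b ^ (-r) := by positivity
        linarith
      · have h1 := ih (2 * b) (by positivity) (by rw [pow_succ] at h; linarith)
        rw [Real.mul_rpow (by norm_num) hb.le] at h1
        have h2 := hblock b hb h'
        -- The constant is the fixed point of `C ↦ 2^{-r} C + M`.
        have h3 : M / (1 - 2 ^ (-r)) * (2 ^ (-r) * b ^ (-r)) + M * b ^ (-r)
            = M / (1 - 2 ^ (-r)) * b ^ (-r) := by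
          have : (1 - (2 : ℝ) ^ (-r)) ≠ 0 := by linarith
          field_simp
          ring
        linarith
  obtain ⟨i, hi⟩ := pow_unbounded_of_one_lt (b₀ / b) (by norm_num : (1 : ℝ) < 2)
  exact key i b hb ((div_lt_iff₀ hb).1 hi).le

theorem exists_large_block {r : ℝ} (hr : 0 < r) {t : ℕ → ℝ} (ht_lt : ∀ n, t n < 1)
    (hw : ¬ MemWeakLorentz r t) {D : ℝ → ℕ}
    (hD : ∀ c, 0 < c → ∀ n, c < t n ↔ n < D c) {M b₀ : ℝ} (hM : 0 ≤ M) (hb₀ : 0 < b₀) :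
    ∃ b, 0 < b ∧ b < b₀ ∧ (D (2 * b) : ℝ) + M * b ^ (-r) < D b := by
  by_contra! hcon
  refine hw ?_
  have hmono : ∀ b c, 0 < b → b ≤ c → D c ≤ D b := fun b c hb hbc => by
    by_contra! h
    have h1 := (hD c (hb.trans_le hbc) (D b)).2 h
    exact lt_irrefl _ ((hD b hb (D b)).1 (hbc.trans_lt h1))
  have hbound := fun b hb => counting_le_of_block_le hr hM hb₀ hmono hcon (b := b) hb
  have h2r : (2 : ℝ) ^ (-r) < 1 := Real.rpow_lt_one_of_one_lt_of_neg (by norm_num) (by linarith)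
  have hC : 0 ≤ M / (1 - 2 ^ (-r)) := div_nonneg hM (by linarith)
  refine lt_of_le_of_lt (iSup_le fun b => ?_)
    (ENNReal.ofReal_lt_top (r := M / (1 - 2 ^ (-r)) + D b₀))
  obtain ⟨b, hb⟩ := b
  have hb0 : 0 < b := hb
  have hset : {n | b < t n} = (Finset.range (D b) : Set ℕ) := by
    ext n
    simp [hD b hb0 n]
  have e : (({n | b < t n} : Set ℕ).encard : ℝ≥0∞) = ENNReal.ofReal (D b) := by
    rw [hset, Set.encard_coe_eq_coe_finsetCard, Finset.card_range]
    simp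
  rw [e, ← ENNReal.ofReal_mul (by positivity)]
  refine ENNReal.ofReal_le_ofReal ?_
  rcases le_or_gt 1 b with h1 | h1
  · have h0 : D b = 0 := by
      by_contra h
      have := (hD b hb0 0).2 (Nat.pos_of_ne_zero h)
      linarith [ht_lt 0]
    rw [h0, Nat.cast_zero, mul_zero]
    positivity
  · have h3 : b ^ r ≤ 1 := Real.rpow_le_one hb0.le h1.le hr.le
    have h4 : b ^ r * b ^ (-r) = 1 := by
      rw [← Real.rpow_add hb0, add_neg_cancel, Real.rpow_zero]
    calc b ^ r * (D b : ℝ) ≤ b ^ r * (M / (1 - 2 ^ (-r)) * b ^ (-r) + D b₀) := by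
          gcongr
          exact hbound b hb0
      _ = M / (1 - 2 ^ (-r)) * (b ^ r * b ^ (-r)) + b ^ r * D b₀ := by ring
      _ ≤ M / (1 - 2 ^ (-r)) * 1 + 1 * D b₀ := by
          rw [h4]
          gcongr
      _ = _ := by ring

/-- Failure of the weak Lorentz condition makes the times `b / N`-dense in `[0, b]` with `N` as
large as any multiple of `b ^ (-r)`, for arbitrarily small `b`. -/
theorem exists_dense_times {r : ℝ} (hr : 0 < r) {t : ℕ → ℝ} (ht_lt : ∀ n, t n < 1)
    (ht_anti : Antitone t) (ht_lim : Tendsto t atTop (𝓝 0))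
    (ht_gap : Antitone fun n => t n - t (n + 1)) (hw : ¬ MemWeakLorentz r t) {M b₀ : ℝ}
    (hM : 0 ≤ M) (hb₀ : 0 < b₀) :
    ∃ b, 0 < b ∧ b < b₀ ∧ ∀ N : ℕ, (N : ℝ) ≤ M * b ^ (-r) → ∀ j < N,
      ∃ n, j * (b / N) ≤ t n ∧ t n ≤ (j + 1) * (b / N) := by
  have hDex : ∀ c : ℝ, ∃ d : ℕ, 0 < c → ∀ n, c < t n ↔ n < d := fun c => by
    by_cases hc : 0 < c
    · obtain ⟨d, hd⟩ := exists_lt_iff ht_anti ht_lim hc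
      exact ⟨d, fun _ => hd⟩
    · exact ⟨0, fun h => absurd h hc⟩
  choose D hD using hDex
  -- `M + 1` and `b < 1` together leave room for one more index, hence for at least `N` full gaps
  -- inside the block `(b, 2b]`.
  obtain ⟨b, hb, hbb, hblock⟩ := exists_large_block hr ht_lt hw hD (M := M + 1) (by linarith)
    (lt_min hb₀ one_pos)
  refine ⟨b, hb, hbb.trans_le (min_le_left _ _), fun N hN j hj => ?_⟩
  have hb1 : b ≤ 1 := (hbb.trans_le (min_le_right _ _)).le
  have hbr : 1 ≤ b ^ (-r) := Real.one_le_rpow_of_pos_of_le_one_of_nonpos hb hb1 (by linarith)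
  have hN0 : 0 < N := by omega
  have hcount : D (2 * b) + N + 1 ≤ D b := by
    have : ((D (2 * b) + N + 1 : ℕ) : ℝ) < D b + 1 := by
      push_cast
      nlinarith
    exact_mod_cast Nat.lt_succ_iff.1 (by exact_mod_cast this)
  obtain ⟨k, hk⟩ : ∃ k, D b = D (2 * b) + k + 1 := ⟨D b - D (2 * b) - 1, by omega⟩
  have hNk : (N : ℝ) ≤ k := by
    have : N ≤ k := by omega
    exact_mod_cast this
  have hN0' : (0 : ℝ) < N := by exact_mod_cast hN0
  have hp : t (D (2 * b)) ≤ 2 * b :=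
    not_lt.1 fun h => lt_irrefl _ ((hD (2 * b) (by positivity) _).1 h)
  have hq : b < t (D (2 * b) + k) := (hD b hb _).2 (by omega)
  -- At least `N` gaps fit into length `b`, so the gap after them, and by monotonicity every later
  -- one, is at most `b / N`.
  have hgap : ∀ m, D (2 * b) + k ≤ m → t m - t (m + 1) ≤ b / N := fun m hm => by
    have h1 := mul_gap_le ht_gap (D (2 * b)) k
    have h2 := ht_gap hm
    simp only at h2
    have h3 : 0 ≤ t m - t (m + 1) := sub_nonneg.2 (ht_anti (Nat.le_succ m))
    rw [le_div_iff₀ hN0']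
    nlinarith
  have hc : 0 < (j + 1) * (b / N) := by positivity
  have hcb : (j + 1) * (b / N) ≤ b := by
    rw [mul_div_assoc', div_le_iff₀ hN0', mul_comm]
    have : (j + 1 : ℝ) ≤ N := by exact_mod_cast hj
    gcongr
  -- The first index at or below the right end of the target interval. The preceding time is above
  -- that end, so this one cannot have jumped past the left end.
  set n := D ((j + 1) * (b / N)) with hn
  have h1 : t n ≤ (j + 1) * (b / N) := not_lt.1 fun h => lt_irrefl _ ((hD _ hc _).1 h)
  have h2 : D (2 * b) + k < n := (hD _ hc _).1 (hcb.trans_lt hq)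
  obtain ⟨m, hm⟩ : ∃ m, n = m + 1 := ⟨n - 1, by omega⟩
  have h3 : (j + 1) * (b / N) < t m := (hD _ hc _).2 (by omega)
  have h4 := hgap m (by omega)
  rw [← hm] at h4
  exact ⟨n, by linarith, h1⟩

/-! ### Fourier identities for Schwartz functions and tensor products. -/

open scoped LineDeriv ContDiff in
theorem fourier_lineDerivOp_apply (F : 𝓢(Plane, ℂ)) (i : Fin 2) (η : Plane) :
    𝓕 (∂_{EuclideanSpace.single i (1 : ℝ)} F) η =
      2 * Real.pi * Complex.I * η i * 𝓕 F η := by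
  have h : (inner ℝ · (EuclideanSpace.single i (1 : ℝ)) : Plane → ℝ).HasTemperateGrowth :=
    ((innerSL ℝ).flip (EuclideanSpace.single i (1 : ℝ))).hasTemperateGrowth
  rw [SchwartzMap.fourier_lineDerivOp_eq, smul_apply,
    SchwartzMap.smulLeftCLM_apply_apply h, EuclideanSpace.inner_single_right]
  simp [mul_assoc]

theorem fourier_compSubConst_apply (F : 𝓢(Plane, ℂ)) (a η : Plane) :
    𝓕 (SchwartzMap.compSubConstCLM ℂ (-a) F) η =
      Complex.exp (Complex.I * ((2 * Real.pi * inner ℝ a η : ℝ) : ℂ)) * 𝓕 F η := by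
  have h := congrFun (VectorFourier.fourierIntegral_comp_add_right Real.fourierChar
    (volume : Measure Plane) (innerₗ Plane) (F : Plane → ℂ) a) η
  have h1 : ((F : Plane → ℂ) ∘ fun x => x + a) = SchwartzMap.compSubConstCLM ℂ (-a) F := by
    ext x
    simp
  rw [h1] at h
  rw [SchwartzMap.fourier_coe, SchwartzMap.fourier_coe]
  refine h.trans ?_
  rw [Circle.smul_def, Real.fourierChar_apply, innerₗ_apply_apply, smul_eq_mul, mul_comm Complex.I]
  rfl

theorem coeFn_fourier_toLp (F : 𝓢(Plane, ℂ)) :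
    ⇑(𝓕 (F.toLp 2 (volume : Measure Plane)) : Lp ℂ 2 (volume : Measure Plane)) =ᵐ[volume]
      ⇑(𝓕 F : 𝓢(Plane, ℂ)) := by
  rw [SchwartzMap.toLp_fourier_eq]
  exact SchwartzMap.coeFn_toLp _ _ _

theorem SchwartzMap.lintegral_enorm_sq_fourier (F : 𝓢(Plane, ℂ)) :
    ∫⁻ η, ‖𝓕 F η‖ₑ ^ 2 = ∫⁻ x, ‖F x‖ₑ ^ 2 := by
  have h := _root_.lintegral_enorm_sq_fourier (F.toLp 2 (volume : Measure Plane))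
  have h1 : ∫⁻ η, ‖(𝓕 (F.toLp 2 (volume : Measure Plane)) : Lp ℂ 2 volume) η‖ₑ ^ 2
      = ∫⁻ η, ‖𝓕 F η‖ₑ ^ 2 := by
    refine lintegral_congr_ae ?_
    filter_upwards [coeFn_fourier_toLp F] with η hη
    rw [hη]
  have h2 : ∫⁻ x, ‖F.toLp 2 (volume : Measure Plane) x‖ₑ ^ 2 = ∫⁻ x, ‖F x‖ₑ ^ 2 := by
    refine lintegral_congr_ae ?_
    filter_upwards [F.coeFn_toLp 2 (volume : Measure Plane)] with x hx
    rw [hx]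
  rw [← h1, h, h2]

theorem lintegral_tensor {a b : ℝ → ℝ≥0∞} (ha : Measurable a) (hb : Measurable b) :
    ∫⁻ x : Plane, a (x 0) * b (x 1) = (∫⁻ x, a x) * ∫⁻ x, b x := by
  have h := (volume_preserving_finTwoArrow ℝ).comp (PiLp.volume_preserving_ofLp (Fin 2))
  have h2 := h.lintegral_comp (f := fun p : ℝ × ℝ => a p.1 * b p.2) (by fun_prop)
  rw [← lintegral_prod_mul ha.aemeasurable hb.aemeasurable]
  exact h2

section Tensor

open scoped ContDiff LineDeriv

variable {u v : ℝ → ℂ}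

theorem hasCompactSupport_tensor (hu : HasCompactSupport u) (hv : HasCompactSupport v) :
    HasCompactSupport fun x : Plane => u (x 0) * v (x 1) := by
  have hK : IsCompact ((EuclideanSpace.equiv (Fin 2) ℝ).toHomeomorph ⁻¹'
      (Set.univ.pi ![tsupport u, tsupport v])) := by
    refine (Homeomorph.isCompact_preimage _).2 (isCompact_univ_pi fun i => ?_)
    fin_cases i
    · exact hu
    · exact hv
  refine HasCompactSupport.intro hK fun x hx => ?_
  by_contra h
  refine hx fun i _ => ?_
  fin_cases i
  · exact subset_tsupport _ (left_ne_zero_of_mul h)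
  · exact subset_tsupport _ (right_ne_zero_of_mul h)

theorem contDiff_tensor (hu : ContDiff ℝ ∞ u) (hv : ContDiff ℝ ∞ v) :
    ContDiff ℝ ∞ fun x : Plane => u (x 0) * v (x 1) := by
  have h : ∀ i, ContDiff ℝ ∞ fun x : Plane => x i := fun i => by fun_prop
  exact (hu.comp (h 0)).mul (hv.comp (h 1))

/-- The Schwartz function `u (x 0) * v (x 1)` on the plane. -/
noncomputable def tensorSchwartz (hu : ContDiff ℝ ∞ u) (hv : ContDiff ℝ ∞ v)
    (hu' : HasCompactSupport u) (hv' : HasCompactSupport v) : 𝓢(Plane, ℂ) :=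
  (hasCompactSupport_tensor hu' hv').toSchwartzMap (contDiff_tensor hu hv)

variable (hu : ContDiff ℝ ∞ u) (hv : ContDiff ℝ ∞ v) (hu' : HasCompactSupport u)
  (hv' : HasCompactSupport v)

theorem tensorSchwartz_apply (x : Plane) : tensorSchwartz hu hv hu' hv' x = u (x 0) * v (x 1) :=
  rfl

theorem lineDerivOp_tensorSchwartz_zero (x : Plane) :
    (∂_{EuclideanSpace.single (0 : Fin 2) (1 : ℝ)} (tensorSchwartz hu hv hu' hv')) x =
      deriv u (x 0) * v (x 1) := by
  rw [SchwartzMap.lineDerivOp_apply, lineDeriv]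
  have h : (fun τ : ℝ => tensorSchwartz hu hv hu' hv'
      (x + τ • EuclideanSpace.single (0 : Fin 2) (1 : ℝ))) = fun τ => u (x 0 + τ) * v (x 1) := by
    ext τ
    rw [tensorSchwartz_apply]
    simp
  rw [h]
  have h1 : HasDerivAt (fun τ : ℝ => u (x 0 + τ)) (deriv u (x 0)) 0 := by
    have := ((hu.differentiable (by simp)) (x 0 + 0)).hasDerivAt.comp_const_add (x 0) 0
    rwa [add_zero] at this
  exact (h1.mul_const _).deriv

theorem lineDerivOp_tensorSchwartz_one (x : Plane) :
    (∂_{EuclideanSpace.single (1 : Fin 2) (1 : ℝ)} (tensorSchwartz hu hv hu' hv')) x =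
      u (x 0) * deriv v (x 1) := by
  rw [SchwartzMap.lineDerivOp_apply, lineDeriv]
  have h : (fun τ : ℝ => tensorSchwartz hu hv hu' hv'
      (x + τ • EuclideanSpace.single (1 : Fin 2) (1 : ℝ))) = fun τ => u (x 0) * v (x 1 + τ) := by
    ext τ
    rw [tensorSchwartz_apply]
    simp
  rw [h]
  have h1 : HasDerivAt (fun τ : ℝ => v (x 1 + τ)) (deriv v (x 1)) 0 := by
    have := ((hv.differentiable (by simp)) (x 1 + 0)).hasDerivAt.comp_const_add (x 1) 0
    rwa [add_zero] at this
  exact (h1.const_mul _).deriv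

theorem lintegral_enorm_mul_sq {a b : ℝ → ℂ} (ha : Continuous a) (hb : Continuous b) :
    ∫⁻ x : Plane, ‖a (x 0) * b (x 1)‖ₑ ^ 2 = (∫⁻ x, ‖a x‖ₑ ^ 2) * ∫⁻ x, ‖b x‖ₑ ^ 2 := by
  rw [← lintegral_tensor (ha.measurable.enorm.pow_const 2) (hb.measurable.enorm.pow_const 2)]
  simp_rw [enorm_mul, mul_pow]

theorem lintegral_tensorSchwartz :
    ∫⁻ η, ‖𝓕 (tensorSchwartz hu hv hu' hv') η‖ₑ ^ 2 =
      (∫⁻ x, ‖u x‖ₑ ^ 2) * ∫⁻ x, ‖v x‖ₑ ^ 2 := by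
  rw [SchwartzMap.lintegral_enorm_sq_fourier, ← lintegral_enorm_mul_sq hu.continuous hv.continuous]
  rfl

theorem lintegral_tensorSchwartz_zero :
    ∫⁻ η : Plane, ‖2 * Real.pi * η 0 * 𝓕 (tensorSchwartz hu hv hu' hv') η‖ₑ ^ 2 =
      (∫⁻ x, ‖deriv u x‖ₑ ^ 2) * ∫⁻ x, ‖v x‖ₑ ^ 2 := by
  rw [← lintegral_enorm_mul_sq (hu.continuous_deriv (by simp)) hv.continuous]
  simp_rw [← lineDerivOp_tensorSchwartz_zero hu hv hu' hv']
  rw [← SchwartzMap.lintegral_enorm_sq_fourier]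
  have hI : ‖Complex.I‖ₑ = 1 := by simp [← ofReal_norm]
  refine lintegral_congr fun η => ?_
  rw [fourier_lineDerivOp_apply]
  simp [enorm_mul, hI]

theorem lintegral_tensorSchwartz_one :
    ∫⁻ η : Plane, ‖2 * Real.pi * η 1 * 𝓕 (tensorSchwartz hu hv hu' hv') η‖ₑ ^ 2 =
      (∫⁻ x, ‖u x‖ₑ ^ 2) * ∫⁻ x, ‖deriv v x‖ₑ ^ 2 := by
  rw [← lintegral_enorm_mul_sq hu.continuous (hv.continuous_deriv (by simp))]
  simp_rw [← lineDerivOp_tensorSchwartz_one hu hv hu' hv']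
  rw [← SchwartzMap.lintegral_enorm_sq_fourier]
  have hI : ‖Complex.I‖ₑ = 1 := by simp [← ofReal_norm]
  refine lintegral_congr fun η => ?_
  rw [fourier_lineDerivOp_apply]
  simp [enorm_mul, hI]

/-- The multiplier `2πη₁ - c` corresponds to `∂₁ - ic` up to a factor `i`, indices starting at 0.
For `v` modulated by `e^{icx}` this operator differentiates only the envelope, so no power of `c` is
lost in that variable. -/
theorem lintegral_tensorSchwartz_mixed (c : ℝ) :
    ∫⁻ η : Plane, ‖2 * Real.pi * η 0 * (2 * Real.pi * η 1 - c) *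
      𝓕 (tensorSchwartz hu hv hu' hv') η‖ₑ ^ 2 =
      (∫⁻ x, ‖deriv u x‖ₑ ^ 2) * ∫⁻ x, ‖deriv v x - Complex.I * c * v x‖ₑ ^ 2 := by
  have hdu : ContDiff ℝ ∞ (deriv u) := ((contDiff_infty_iff_deriv).1 hu).2
  have hcont : Continuous fun x => deriv v x - Complex.I * c * v x :=
    (hv.continuous_deriv (by simp)).sub (continuous_const.mul hv.continuous)
  rw [← lintegral_enorm_mul_sq (hu.continuous_deriv (by simp)) hcont]
  set G : 𝓢(Plane, ℂ) := ∂_{EuclideanSpace.single (1 : Fin 2) (1 : ℝ)}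
      (tensorSchwartz hdu hv hu'.deriv hv') +
    (-(Complex.I * c)) • tensorSchwartz hdu hv hu'.deriv hv' with hG
  have hGx : ∀ x, G x = deriv u (x 0) * (deriv v (x 1) - Complex.I * c * v (x 1)) := fun x => by
    rw [hG, add_apply, lineDerivOp_tensorSchwartz_one, smul_apply,
      tensorSchwartz_apply, smul_eq_mul]
    ring
  simp_rw [← hGx]
  rw [← SchwartzMap.lintegral_enorm_sq_fourier]
  have h1 : tensorSchwartz hdu hv hu'.deriv hv' =
      ∂_{EuclideanSpace.single (0 : Fin 2) (1 : ℝ)} (tensorSchwartz hu hv hu' hv') := by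
    ext x
    rw [lineDerivOp_tensorSchwartz_zero, tensorSchwartz_apply]
  refine lintegral_congr fun η => ?_
  have h2 : 𝓕 G η = -(2 * Real.pi * η 0 * (2 * Real.pi * η 1 - c) *
      𝓕 (tensorSchwartz hu hv hu' hv') η) := by
    rw [hG, FourierTransform.fourier_add, FourierTransform.fourier_smul, add_apply,
      smul_apply, fourier_lineDerivOp_apply, h1, fourier_lineDerivOp_apply, smul_eq_mul]
    linear_combination (2 * Real.pi * η 0 * (2 * Real.pi * η 1 - c) *
      𝓕 (tensorSchwartz hu hv hu' hv') η) * Complex.I_sq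
  rw [h2, enorm_neg]

end Tensor

/-! ### Comparison with a translation, and the Sobolev norm at scale `c`. -/

theorem norm_exp_sub_boxSymbol_le (τ c : ℝ) (η : Plane) :
    ‖boxSymbol τ η - Complex.exp (Complex.I * ((τ * c * (2 * Real.pi * η 0) : ℝ) : ℂ))‖ ≤
      |τ| * ‖(2 * Real.pi * η 0 * (2 * Real.pi * η 1 - c) : ℂ)‖ := by
  refine (norm_exp_sub_exp_le _ _).trans (le_of_eq ?_)
  have : (2 * Real.pi * η 0 * (2 * Real.pi * η 1 - c) : ℂ) =
      ((2 * Real.pi * η 0 * (2 * Real.pi * η 1 - c) : ℝ) : ℂ) := by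
    push_cast
    rfl
  rw [this, Complex.norm_real, Real.norm_eq_abs, ← abs_mul]
  congr 1
  ring

/-- Near the frequency `(0, c)` the flow is the translation by `τ c` in the first variable. -/
theorem lintegral_boxMean_sub_translate_le (F : 𝓢(Plane, ℂ)) (τ c : ℝ) :
    ∫⁻ x, ‖boxMean τ (F.toLp 2 volume) x -
        F (x + EuclideanSpace.single (0 : Fin 2) (τ * c))‖ₑ ^ 2 ≤
      ENNReal.ofReal (τ ^ 2) * ∫⁻ η : Plane, ‖2 * Real.pi * η 0 * (2 * Real.pi * η 1 - c) *
        𝓕 F η‖ₑ ^ 2 := by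
  set a : Plane := EuclideanSpace.single (0 : Fin 2) (τ * c) with ha
  set G : 𝓢(Plane, ℂ) := SchwartzMap.compSubConstCLM ℂ (-a) F with hG
  have h1 : ∫⁻ x, ‖boxMean τ (F.toLp 2 volume) x - F (x + a)‖ₑ ^ 2 =
      ∫⁻ x, ‖boxMean τ (F.toLp 2 volume) x - G.toLp 2 (volume : Measure Plane) x‖ₑ ^ 2 := by
    refine lintegral_congr_ae ?_
    filter_upwards [G.coeFn_toLp 2 (volume : Measure Plane)] with x hx
    rw [hx, hG, SchwartzMap.compSubConstCLM_apply, sub_neg_eq_add]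
  rw [h1, lintegral_enorm_sub_sq, ← lintegral_const_mul' _ _ ENNReal.ofReal_ne_top]
  refine lintegral_mono_ae ?_
  filter_upwards [coeFn_fourier_boxMean τ (F.toLp 2 volume), coeFn_fourier_toLp F,
    coeFn_fourier_toLp G] with η h2 h3 h4
  rw [h2, h3, h4, hG, fourier_compSubConst_apply, ← sub_mul, enorm_mul, mul_pow, enorm_mul, mul_pow,
    ← mul_assoc]
  refine mul_le_mul_left ?_ _
  have e : 2 * Real.pi * inner ℝ a η = τ * c * (2 * Real.pi * η 0) := by
    rw [ha, EuclideanSpace.inner_single_left]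
    simp
    ring
  rw [e, ← ofReal_norm, ← ofReal_norm, ← ENNReal.ofReal_pow (norm_nonneg _),
    ← ENNReal.ofReal_pow (norm_nonneg _), ← ENNReal.ofReal_mul (sq_nonneg _)]
  refine ENNReal.ofReal_le_ofReal ?_
  rw [← sq_abs τ, ← mul_pow]
  exact pow_le_pow_left₀ (norm_nonneg _) (norm_exp_sub_boxSymbol_le τ c η) 2

/-- Replaces the fractional weight by an `L²` and a gradient term balanced at frequency `c`, both of
which can be evaluated on tensor products. -/
theorem rpow_le_mul_one_add {y c s : ℝ} (hy : 0 ≤ y) (hc : 0 < c) (hs : 0 ≤ s) (hs1 : s ≤ 1) :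
    y ^ s ≤ c ^ (2 * s) * (1 + y / c ^ 2) := by
  have h1 : y = c ^ 2 * (y / c ^ 2) := by field_simp
  have h2 : (y / c ^ 2) ^ s ≤ 1 + y / c ^ 2 := by
    calc (y / c ^ 2) ^ s ≤ (1 + y / c ^ 2) ^ s := by
          refine Real.rpow_le_rpow (by positivity) (by linarith) hs
      _ ≤ (1 + y / c ^ 2) ^ (1 : ℝ) :=
          Real.rpow_le_rpow_of_exponent_le (by linarith [div_nonneg hy (sq_nonneg c)]) hs1
      _ = _ := Real.rpow_one _
  calc y ^ s = (c ^ 2) ^ s * (y / c ^ 2) ^ s := by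
        rw [← Real.mul_rpow (by positivity) (by positivity), ← h1]
    _ = c ^ (2 * s) * (y / c ^ 2) ^ s := by
        rw [Real.rpow_mul hc.le, Real.rpow_two]
    _ ≤ _ := by gcongr

theorem exists_besselMul_eq_fourier_toLp {s c : ℝ} (hs : 0 ≤ s) (hs1 : s ≤ 1) (hc : 1 ≤ c)
    (F : 𝓢(Plane, ℂ)) :
    ∃ g : Lp ℂ 2 (volume : Measure Plane), 𝓕 (F.toLp 2 volume) = besselMul hs g ∧
      ‖g‖ₑ ^ 2 ≤ ENNReal.ofReal (c ^ (2 * s)) * (2 * (∫⁻ η, ‖𝓕 F η‖ₑ ^ 2) +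
        ENNReal.ofReal ((c ^ 2)⁻¹) * ((∫⁻ η : Plane, ‖2 * Real.pi * η 0 * 𝓕 F η‖ₑ ^ 2) +
          ∫⁻ η : Plane, ‖2 * Real.pi * η 1 * 𝓕 F η‖ₑ ^ 2)) := by
  have hF : TemperedDistribution.MemSobolev s 2
      ((F.toLp 2 (volume : Measure Plane) : Lp ℂ 2 volume) : 𝓢'(Plane, ℂ)) := by
    rw [Lp.toTemperedDistribution_toLp_eq]
    exact F.memSobolev
  obtain ⟨g, hg⟩ := (memSobolev_iff_exists_fourier_eq_besselMul hs _).1 hF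
  refine ⟨g, hg, ?_⟩
  have hm : Measurable fun η : Plane => ‖𝓕 F η‖ₑ ^ 2 :=
    (𝓕 F).continuous.measurable.enorm.pow_const 2
  have hmi : ∀ i, Measurable fun η : Plane => ‖2 * Real.pi * η i * 𝓕 F η‖ₑ ^ 2 := fun i => by
    have := (𝓕 F).continuous
    exact (by fun_prop : Continuous fun η : Plane =>
      (2 * Real.pi * η i * 𝓕 F η : ℂ)).measurable.enorm.pow_const 2
  rw [Lp.enorm_sq_eq_lintegral, ← lintegral_add_left (hmi 0), ← lintegral_const_mul _ hm,
    ← lintegral_const_mul' _ _ ENNReal.ofReal_ne_top, ← lintegral_add_left (hm.const_mul _),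
    ← lintegral_const_mul' _ _ ENNReal.ofReal_ne_top]
  refine lintegral_mono_ae ?_
  filter_upwards [coeFn_besselMul hs g, coeFn_fourier_toLp F] with η h1 h2
  rw [← hg, h2] at h1
  have hsq : ∀ z : ℂ, ‖z‖ₑ ^ 2 = ENNReal.ofReal (‖z‖ ^ 2) := fun z => by
    rw [ENNReal.ofReal_pow (norm_nonneg _), ofReal_norm]
  have e2 : ∀ a : ℝ, 2 * ENNReal.ofReal a = ENNReal.ofReal (2 * a) := fun a => by
    rw [ENNReal.ofReal_mul (by norm_num)]
    norm_num
  simp only [hsq]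
  rw [← ENNReal.ofReal_add (by positivity) (by positivity), e2,
    ← ENNReal.ofReal_mul (by positivity), ← ENNReal.ofReal_add (by positivity) (by positivity),
    ← ENNReal.ofReal_mul (by positivity)]
  refine ENNReal.ofReal_le_ofReal ?_
  have h3 : ‖g η‖ ^ 2 = (1 + ‖η‖ ^ 2) ^ s * ‖𝓕 F η‖ ^ 2 := by
    rw [h1, norm_mul, mul_pow, norm_besselWeight_sq, ← mul_assoc, ← Real.rpow_add (by positivity),
      add_neg_cancel, Real.rpow_zero, one_mul]
  have h4 : ∀ i, ‖(2 * Real.pi * η i * 𝓕 F η : ℂ)‖ ^ 2 =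
      (2 * Real.pi) ^ 2 * η i ^ 2 * ‖𝓕 F η‖ ^ 2 := fun i => by
    rw [norm_mul, norm_mul, mul_pow, mul_pow, Complex.norm_real, Real.norm_eq_abs, sq_abs]
    congr 3
    simp [abs_of_pos Real.pi_pos]
  rw [h3, h4, h4]
  have hη : ‖η‖ ^ 2 = η 0 ^ 2 + η 1 ^ 2 := by
    rw [EuclideanSpace.norm_sq_eq, Fin.sum_univ_two, Real.norm_eq_abs, Real.norm_eq_abs, sq_abs,
      sq_abs]
  have h5 := rpow_le_mul_one_add (y := 1 + ‖η‖ ^ 2) (by positivity) (by linarith : 0 < c) hs hs1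
  have h6 : (1 + ‖η‖ ^ 2) / c ^ 2 ≤ 1 + (c ^ 2)⁻¹ * ((2 * Real.pi) ^ 2 * ‖η‖ ^ 2) := by
    rw [add_div, one_div, div_eq_inv_mul]
    have h7 : (c ^ 2)⁻¹ ≤ 1 := inv_le_one_of_one_le₀ (one_le_pow₀ hc)
    have h8 : 1 ≤ (2 * Real.pi) ^ 2 := one_le_pow₀ (by linarith [Real.pi_gt_three])
    have h9 : ‖η‖ ^ 2 ≤ (2 * Real.pi) ^ 2 * ‖η‖ ^ 2 :=
      le_mul_of_one_le_left (by positivity) h8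
    gcongr
  calc (1 + ‖η‖ ^ 2) ^ s * ‖𝓕 F η‖ ^ 2
      ≤ (c ^ (2 * s) * (1 + (1 + (c ^ 2)⁻¹ * ((2 * Real.pi) ^ 2 * ‖η‖ ^ 2)))) * ‖𝓕 F η‖ ^ 2 := by
        gcongr
        exact h5.trans (by gcongr)
    _ = _ := by
        rw [hη]
        ring

/-! ### Bump trains and modulated bumps. -/

/-- A train of `K` copies of `χ`, rescaled to width `1 / c` and spaced by `N / c`. -/
noncomputable def bumpTrain (χ : ℝ → ℂ) (c : ℝ) (N K : ℕ) (x : ℝ) : ℂ :=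
  ∑ k ∈ Finset.range K, χ (c * x - N * k)

section BumpTrain

open scoped ContDiff

variable {χ : ℝ → ℂ}

/-- Supports have length 4 in the variable `c x` and centres are at least 5 apart, so at most one
summand is nonzero. -/
theorem enorm_bumpTrain_sq (hsupp : ∀ x, 2 < |x| → χ x = 0) {N : ℕ} (hN : 5 ≤ N) (c : ℝ) (K : ℕ)
    (x : ℝ) :
    ‖bumpTrain χ c N K x‖ₑ ^ 2 = ∑ k ∈ Finset.range K, ‖χ (c * x - N * k)‖ₑ ^ 2 := by
  unfold bumpTrain
  by_cases h : ∃ k ∈ Finset.range K, χ (c * x - N * k) ≠ 0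
  · obtain ⟨k, hk, hχ⟩ := h
    have huniq : ∀ i ∈ Finset.range K, i ≠ k → χ (c * x - N * i) = 0 := fun i _ hik => by
      refine hsupp _ ?_
      by_contra! hi
      have hk' : |c * x - N * k| ≤ 2 := by
        by_contra! hk'
        exact hχ (hsupp _ hk')
      have h1 : |(N : ℝ) * ((i : ℝ) - k)| ≤ 4 := by
        have := abs_sub (c * x - N * k) (c * x - N * i)
        have e : c * x - N * k - (c * x - N * i) = (N : ℝ) * ((i : ℝ) - k) := by ring
        rw [e] at this
        linarith
      have h2 : (1 : ℝ) ≤ |(i : ℝ) - k| := by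
        have : (1 : ℤ) ≤ |(i : ℤ) - k| := Int.one_le_abs (by omega)
        exact_mod_cast this
      have h3 : (5 : ℝ) ≤ N := by exact_mod_cast hN
      rw [abs_mul, Nat.abs_cast] at h1
      nlinarith
    rw [Finset.sum_eq_single k huniq (fun h => absurd hk h),
      Finset.sum_eq_single k (fun i hi hik => by simp [huniq i hi hik]) (fun h => absurd hk h)]
  · push Not at h
    rw [Finset.sum_eq_zero h, Finset.sum_eq_zero fun k hk => by simp [h k hk]]
    simp

theorem lintegral_comp_mul_sub {a : ℝ → ℝ≥0∞} (ha : Measurable a) {c : ℝ} (hc : 0 < c) (d : ℝ) :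
    ∫⁻ x, a (c * x - d) = ENNReal.ofReal c⁻¹ * ∫⁻ x, a x := by
  have h1 : ∫⁻ x, a (x - d) = ∫⁻ x, a x := lintegral_sub_right_eq_self a d
  have hm : Measurable fun x => a (x - d) := ha.comp (measurable_id.sub_const d)
  rw [← h1, ← lintegral_map (f := fun y => a (y - d)) hm (measurable_const_mul c),
    Real.map_volume_mul_left hc.ne', lintegral_smul_measure, abs_of_pos (inv_pos.2 hc), smul_eq_mul]

theorem lintegral_bumpTrain (hχ : Continuous χ) (hsupp : ∀ x, 2 < |x| → χ x = 0) {N : ℕ}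
    (hN : 5 ≤ N) {c : ℝ} (hc : 0 < c) (K : ℕ) :
    ∫⁻ x, ‖bumpTrain χ c N K x‖ₑ ^ 2 = K * ENNReal.ofReal c⁻¹ * ∫⁻ x, ‖χ x‖ₑ ^ 2 := by
  simp_rw [enorm_bumpTrain_sq hsupp hN]
  have hm : Measurable fun x => ‖χ x‖ₑ ^ 2 := hχ.measurable.enorm.pow_const 2
  have hmk : ∀ k : ℕ, Measurable fun x => ‖χ (c * x - N * k)‖ₑ ^ 2 := fun k =>
    hm.comp ((measurable_const_mul c).sub_const _)
  rw [lintegral_finsetSum _ fun k _ => hmk k,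
    Finset.sum_congr rfl fun (k : ℕ) _ => lintegral_comp_mul_sub hm hc ((N : ℝ) * k),
    Finset.sum_const, Finset.card_range, nsmul_eq_mul, mul_assoc]

theorem contDiff_bumpTrain (hχ : ContDiff ℝ ∞ χ) (c : ℝ) (N K : ℕ) :
    ContDiff ℝ ∞ (bumpTrain χ c N K) := by
  unfold bumpTrain
  exact ContDiff.sum fun k _ => hχ.comp (by fun_prop)

theorem hasCompactSupport_bumpTrain (hsupp : ∀ x, 2 < |x| → χ x = 0) {c : ℝ} (hc : 0 < c)
    (N K : ℕ) : HasCompactSupport (bumpTrain χ c N K) := by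
  refine HasCompactSupport.intro (isCompact_Icc (a := -2 / c) (b := (2 + N * K) / c)) fun x hx => ?_
  refine Finset.sum_eq_zero fun k hk => hsupp _ ?_
  by_contra! h
  rw [abs_le] at h
  have hkK : (k : ℝ) ≤ K := by exact_mod_cast (Finset.mem_range.1 hk).le
  have h1 : (N : ℝ) * k ≤ N * K := by gcongr
  have h0 : (0 : ℝ) ≤ N * k := by positivity
  refine hx ⟨?_, ?_⟩
  · rw [div_le_iff₀ hc]
    linarith
  · rw [le_div_iff₀ hc]
    linarith

theorem deriv_bumpTrain (hχ : ContDiff ℝ ∞ χ) (c : ℝ) (N K : ℕ) (x : ℝ) :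
    deriv (bumpTrain χ c N K) x = c * bumpTrain (deriv χ) c N K x := by
  have h : ∀ k ∈ Finset.range K, HasDerivAt (fun x => χ (c * x - N * k))
      (c * deriv χ (c * x - N * k)) x := fun k _ => by
    have h1 : HasDerivAt (fun x : ℝ => c * x - N * k) c x := by
      simpa using ((hasDerivAt_id x).const_mul c).sub_const ((N : ℝ) * k)
    have h2 := (hχ.differentiable (by simp) (c * x - N * k)).hasDerivAt.scomp x h1
    rw [Complex.real_smul] at h2
    exact h2
  have := (HasDerivAt.fun_sum h).deriv
  unfold bumpTrain
  rw [this, Finset.mul_sum]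

theorem deriv_eq_zero_of_support (hsupp : ∀ x, 2 < |x| → χ x = 0) (x : ℝ) (hx : 2 < |x|) :
    deriv χ x = 0 := by
  have h : χ =ᶠ[𝓝 x] fun _ => 0 := by
    filter_upwards [(isOpen_lt continuous_const continuous_abs).mem_nhds hx] with y hy
    exact hsupp y hy
  rw [h.deriv_eq, deriv_const]

theorem lintegral_enorm_sq_lt_top {χ : ℝ → ℂ} (hχ : Continuous χ) (hχ' : HasCompactSupport χ) :
    ∫⁻ x, ‖χ x‖ₑ ^ 2 < (⊤ : ℝ≥0∞) := by
  have h1 : HasCompactSupport fun x => ‖χ x‖ ^ 2 :=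
    hχ'.comp_left (g := fun z : ℂ => ‖z‖ ^ 2) (by simp)
  have h := ((hχ.norm.pow 2).integrable_of_hasCompactSupport (μ := volume) h1).2
  rw [hasFiniteIntegral_iff_enorm] at h
  simpa using h

/-- The modulated bump `χ(x) e^{icx}`. -/
noncomputable def modulated (χ : ℝ → ℂ) (c x : ℝ) : ℂ := χ x * Complex.exp (Complex.I * (c * x : ℝ))

theorem enorm_exp_I_mul (a : ℝ) : ‖Complex.exp (Complex.I * a)‖ₑ = 1 := by
  rw [← ofReal_norm, mul_comm, Complex.norm_exp_ofReal_mul_I, ENNReal.ofReal_one]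

theorem contDiff_modulated (hχ : ContDiff ℝ ∞ χ) (c : ℝ) : ContDiff ℝ ∞ (modulated χ c) := by
  unfold modulated
  refine hχ.mul (ContDiff.cexp (contDiff_const.mul (Complex.ofRealCLM.contDiff.comp ?_)))
  exact contDiff_const.mul contDiff_id

theorem deriv_modulated (hχ : ContDiff ℝ ∞ χ) (c x : ℝ) :
    deriv (modulated χ c) x = modulated (deriv χ) c x + Complex.I * c * modulated χ c x := by
  have h1 : HasDerivAt (fun x : ℝ => Complex.I * ((c * x : ℝ) : ℂ)) (Complex.I * c) x := by
    have : HasDerivAt (fun x : ℝ => ((c * x : ℝ) : ℂ)) c x := by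
      simpa using (((hasDerivAt_id x).const_mul c).ofReal_comp)
    exact this.const_mul _
  have h2 := ((hχ.differentiable (by simp) x).hasDerivAt.mul h1.cexp).deriv
  refine h2.trans ?_
  unfold modulated
  ring

theorem lintegral_modulated (χ : ℝ → ℂ) (c : ℝ) :
    ∫⁻ x, ‖modulated χ c x‖ₑ ^ 2 = ∫⁻ x, ‖χ x‖ₑ ^ 2 := by
  refine lintegral_congr fun x => ?_
  rw [modulated, enorm_mul, enorm_exp_I_mul, mul_one]

theorem enorm_add_sq_le (a b : ℂ) : ‖a + b‖ₑ ^ 2 ≤ 2 * ‖a‖ₑ ^ 2 + 2 * ‖b‖ₑ ^ 2 := by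
  have h : ‖a + b‖ ^ 2 ≤ 2 * ‖a‖ ^ 2 + 2 * ‖b‖ ^ 2 := by
    have := pow_le_pow_left₀ (norm_nonneg _) (norm_add_le a b) 2
    nlinarith [sq_nonneg (‖a‖ - ‖b‖)]
  have h2 := ENNReal.ofReal_le_ofReal h
  rw [ENNReal.ofReal_add (by positivity) (by positivity), ENNReal.ofReal_mul (by norm_num),
    ENNReal.ofReal_mul (by norm_num)] at h2
  simpa [ENNReal.ofReal_pow, ofReal_norm] using h2

theorem lintegral_deriv_modulated_le (hχ : ContDiff ℝ ∞ χ) {c : ℝ} (hc : 0 ≤ c) :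
    ∫⁻ x, ‖deriv (modulated χ c) x‖ₑ ^ 2 ≤
      2 * (∫⁻ x, ‖deriv χ x‖ₑ ^ 2) + ENNReal.ofReal (c ^ 2) * (2 * ∫⁻ x, ‖χ x‖ₑ ^ 2) := by
  have hm : Measurable fun x => ‖modulated (deriv χ) c x‖ₑ ^ 2 := by
    have h1 := (contDiff_modulated ((contDiff_infty_iff_deriv).1 hχ).2 c).continuous
    exact h1.measurable.enorm.pow_const 2
  rw [← lintegral_modulated (deriv χ) c, ← lintegral_modulated χ c,
    ← lintegral_const_mul' _ _ (by simp), ← lintegral_const_mul' _ _ (by simp),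
    ← lintegral_const_mul' _ _ (by simp), ← lintegral_add_left (hm.const_mul _)]
  refine lintegral_mono fun x => ?_
  simp only
  rw [deriv_modulated hχ]
  refine (enorm_add_sq_le _ _).trans (le_of_eq ?_)
  have hI : ‖Complex.I‖ₑ = 1 := by simp [← ofReal_norm]
  have hcc : ‖(c : ℂ)‖ₑ = ENNReal.ofReal c := by
    rw [← ofReal_norm, Complex.norm_real, Real.norm_eq_abs, abs_of_nonneg hc]
  rw [enorm_mul, enorm_mul, hI, hcc, one_mul, mul_pow, ENNReal.ofReal_pow hc]
  ring

theorem lintegral_deriv_modulated_sub (hχ : ContDiff ℝ ∞ χ) (c : ℝ) :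
    ∫⁻ x, ‖deriv (modulated χ c) x - Complex.I * c * modulated χ c x‖ₑ ^ 2 =
      ∫⁻ x, ‖deriv χ x‖ₑ ^ 2 := by
  rw [← lintegral_modulated (deriv χ) c]
  refine lintegral_congr fun x => ?_
  rw [deriv_modulated hχ, add_sub_cancel_right]

end BumpTrain

/-! ### The test function. -/

/-- In the variable `c x` the next centre to the right is at distance `y ∈ [0, N)`. With `j = ⌊y⌋`
the translation moves the point by `τ c² ∈ [j, j + 1]`, hence to within 1 of that centre, where the
bump equals 1. -/
theorem one_le_norm_bumpTrain {φ : ℝ → ℝ} (h0 : ∀ x, 0 ≤ φ x) (h1 : ∀ x, |x| ≤ 1 → φ x = 1)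
    {c : ℝ} (hc : 0 < c) {N K : ℕ} (hN : 0 < N) (hK : ⌈c / N⌉₊ < K) {x : ℝ}
    (hx : x ∈ Set.Icc (0 : ℝ) 1) :
    ∃ j < N, ∀ τ : ℝ, j / c ^ 2 ≤ τ → τ ≤ (j + 1) / c ^ 2 →
      1 ≤ ‖bumpTrain (fun x => (φ x : ℂ)) c N K (x + τ * c)‖ := by
  have hN' : (0 : ℝ) < N := by exact_mod_cast hN
  set k := ⌈c * x / N⌉₊ with hk
  have hk1 : c * x ≤ N * k := by
    have := Nat.le_ceil (c * x / N)
    rwa [div_le_iff₀' hN'] at this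
  have hk2 : N * k - c * x < N := by
    have := Nat.ceil_lt_add_one (a := c * x / N) (by have := hx.1; positivity)
    rw [← hk, ← sub_lt_iff_lt_add, lt_div_iff₀' hN'] at this
    linarith
  have hkK : k < K := by
    refine lt_of_le_of_lt (Nat.ceil_mono ?_) hK
    gcongr
    exact mul_le_of_le_one_right hc.le hx.2
  set y : ℝ := N * k - c * x with hy
  have hy0 : 0 ≤ y := by linarith
  refine ⟨⌊y⌋₊, (Nat.floor_lt hy0).2 hk2, fun τ hτ1 hτ2 => ?_⟩
  have hy1 := Nat.floor_le hy0
  have hy2 := Nat.lt_floor_add_one y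
  rw [div_le_iff₀ (by positivity)] at hτ1
  rw [le_div_iff₀ (by positivity)] at hτ2
  have harg : φ (c * (x + τ * c) - N * k) = 1 := by
    refine h1 _ ?_
    have e : c * (x + τ * c) - N * k = τ * c ^ 2 - y := by
      rw [hy]
      ring
    rw [e, abs_le]
    constructor <;> linarith
  have e : bumpTrain (fun x => (φ x : ℂ)) c N K (x + τ * c) =
      ((∑ k ∈ Finset.range K, φ (c * (x + τ * c) - N * k) : ℝ) : ℂ) := by
    rw [bumpTrain, Complex.ofReal_sum]
  rw [e, Complex.norm_real, Real.norm_eq_abs]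
  refine le_trans ?_ (le_abs_self _)
  rw [← harg]
  exact Finset.single_le_sum (f := fun k : ℕ => φ (c * (x + τ * c) - N * k))
    (fun _ _ => h0 _) (Finset.mem_range.2 hkK)

/-- The unit square. -/
def unitSquare : Set Plane := {x | x 0 ∈ Set.Icc (0 : ℝ) 1 ∧ x 1 ∈ Set.Icc (0 : ℝ) 1}

theorem measurableSet_unitSquare : MeasurableSet unitSquare := by
  have h : ∀ i : Fin 2, Measurable fun x : Plane => x i := fun i => by fun_prop
  exact ((h 0) measurableSet_Icc).inter ((h 1) measurableSet_Icc)

theorem volume_unitSquare : volume unitSquare = 1 := by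
  have hI : MeasurableSet (Set.Icc (0 : ℝ) 1) := measurableSet_Icc
  have h := lintegral_tensor (measurable_one.indicator hI) (measurable_one.indicator hI)
  rw [lintegral_indicator_one hI, Real.volume_Icc] at h
  rw [← lintegral_indicator_one measurableSet_unitSquare]
  refine (lintegral_congr fun x => ?_).trans (h.trans (by simp))
  by_cases h0 : x 0 ∈ Set.Icc (0 : ℝ) 1 <;> by_cases h1 : x 1 ∈ Set.Icc (0 : ℝ) 1 <;>
    simp only [unitSquare, Set.indicator, Set.mem_ofPred_eq, h0, h1, and_self, and_true, and_false,
      if_true, if_false, Pi.one_apply, mul_one, mul_zero]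

/-- Chebyshev: on `S` some difference is at least `1/2`, so the sum of squares is at least `1/4`. -/
theorem measure_le_of_sum_sq {N : ℕ} {S : Set Plane} {a b : ℕ → Plane → ℂ}
    (hm : ∀ j, AEMeasurable (fun x => ‖a j x - b j x‖ₑ ^ 2) (volume : Measure Plane))
    (hS : ∀ x ∈ S, ∃ j < N, 1 ≤ ‖b j x‖ ∧ ‖a j x‖ ≤ 1 / 2) :
    volume S ≤ 4 * ∑ j ∈ Finset.range N, ∫⁻ x, ‖a j x - b j x‖ₑ ^ 2 := by
  have hsub : S ⊆ {x | (4 : ℝ≥0∞)⁻¹ ≤ ∑ j ∈ Finset.range N, ‖a j x - b j x‖ₑ ^ 2} := fun x hx => by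
    obtain ⟨j, hj, hb, ha⟩ := hS x hx
    refine le_trans ?_ (Finset.single_le_sum (f := fun j => ‖a j x - b j x‖ₑ ^ 2)
      (fun _ _ => zero_le) (Finset.mem_range.2 hj))
    have h1 : 1 / 2 ≤ ‖a j x - b j x‖ := by
      have := norm_sub_norm_le (b j x) (a j x)
      rw [norm_sub_rev] at this
      linarith
    have h2 : (4 : ℝ≥0∞)⁻¹ = ENNReal.ofReal ((1 / 2) ^ 2) := by
      rw [one_div, inv_pow, ENNReal.ofReal_inv_of_pos (by norm_num)]
      norm_num
    rw [h2, ← ofReal_norm, ← ENNReal.ofReal_pow (norm_nonneg _)]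
    exact ENNReal.ofReal_le_ofReal (by gcongr)
  have h := mul_meas_ge_le_lintegral₀
    (Finset.aemeasurable_fun_sum (Finset.range N) fun j _ => hm j) (4 : ℝ≥0∞)⁻¹
  rw [lintegral_finsetSum' _ fun j _ => hm j, mul_comm, ← div_eq_mul_inv,
    ENNReal.div_le_iff (by simp) (by simp), mul_comm] at h
  exact (measure_mono hsub).trans h

section TestFunction

open scoped ContDiff

/-- The main example: a Schwartz function, small in `H^s`, whose means at `N` equidistributed times
are jointly large on almost all of the unit square. -/
theorem exists_test_function : ∃ C : ℝ≥0∞, C ≠ ⊤ ∧ ∀ (s : ℝ) (hs : 0 ≤ s), s ≤ 1 →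
    ∀ (N : ℕ) (c : ℝ), 5 ≤ N → N ≤ c → ∃ (f g : Lp ℂ 2 (volume : Measure Plane)),
      𝓕 f = besselMul hs g ∧ ‖g‖ₑ ^ 2 ≤ ENNReal.ofReal (c ^ (2 * s) / N) * C ∧
      ∀ τ : ℕ → ℝ, (∀ j < N, j / c ^ 2 ≤ τ j ∧ τ j ≤ (j + 1) / c ^ 2) →
        volume {x ∈ unitSquare | ∀ j < N, ‖boxMean (τ j) f x‖ ≤ 1 / 2} ≤
          ENNReal.ofReal ((N / c) ^ 2) * C := by
  let φ : ContDiffBump (0 : ℝ) := ⟨1, 2, one_pos, one_lt_two⟩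
  set χ : ℝ → ℂ := fun x => (φ x : ℂ) with hχ_def
  have hχ : ContDiff ℝ ∞ χ := Complex.ofRealCLM.contDiff.comp φ.contDiff
  have hsupp : ∀ x, 2 < |x| → χ x = 0 := fun x hx => by
    rw [hχ_def]
    simp only [Complex.ofReal_eq_zero]
    refine φ.zero_of_le_dist ?_
    rw [Real.dist_eq, sub_zero]
    exact hx.le
  have hφ1 : ∀ x : ℝ, |x| ≤ 1 → φ x = 1 := fun x hx =>
    φ.one_of_mem_closedBall (by rwa [mem_closedBall_zero_iff])
  have hχc : HasCompactSupport χ := φ.hasCompactSupport.comp_left (g := Complex.ofReal) (by simp)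
  have hdχ : ContDiff ℝ ∞ (deriv χ) := ((contDiff_infty_iff_deriv).1 hχ).2
  set C₀ := ∫⁻ x, ‖χ x‖ₑ ^ 2 with hC₀
  set C₁ := ∫⁻ x, ‖deriv χ x‖ₑ ^ 2 with hC₁
  have hC₀' : C₀ ≠ ⊤ := (lintegral_enorm_sq_lt_top hχ.continuous hχc).ne
  have hC₁' : C₁ ≠ ⊤ := (lintegral_enorm_sq_lt_top hdχ.continuous hχc.deriv).ne
  refine ⟨3 * (4 * C₀ ^ 2 + 3 * (C₀ * C₁)) + 12 * C₁ ^ 2, ?_, fun s hs hs1 N c hN hNc => ?_⟩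
  · finiteness
  have hN5 : (5 : ℝ) ≤ N := by exact_mod_cast hN
  have hN0 : (0 : ℝ) < N := by linarith
  have hc1 : 1 ≤ c := by linarith
  have hc0 : 0 < c := by linarith
  -- Enough bumps at spacing `N / c` to reach past 1. The mass `A = K / c` is then at most `3 / N`,
  -- the gain from the sparsity of the train.
  set K := ⌈c / N⌉₊ + 1 with hK
  set A : ℝ≥0∞ := K * ENNReal.ofReal c⁻¹ with hA
  have hA3 : A ≤ ENNReal.ofReal (3 / N) := by
    have h1 : (K : ℝ≥0∞) = ENNReal.ofReal K := by simp
    rw [hA, h1, ← ENNReal.ofReal_mul (by positivity)]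
    refine ENNReal.ofReal_le_ofReal ?_
    have h2 := (Nat.ceil_lt_add_one (a := c / N) (by positivity)).le
    have h3 : 1 ≤ c / N := by rwa [one_le_div hN0]
    have h4 : (K : ℝ) ≤ 3 * (c / N) := by
      rw [hK]
      push_cast
      linarith
    calc (K : ℝ) * c⁻¹ ≤ 3 * (c / N) * c⁻¹ := by gcongr
      _ = 3 / N := by field_simp
  have hu := contDiff_bumpTrain hχ c N K
  have hu' := hasCompactSupport_bumpTrain hsupp hc0 N K
  have hv := contDiff_modulated hχ c
  have hv' : HasCompactSupport (modulated χ c) := hχc.mul_right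
  have hU0 : ∫⁻ x, ‖bumpTrain χ c N K x‖ₑ ^ 2 = A * C₀ :=
    lintegral_bumpTrain hχ.continuous hsupp hN hc0 K
  have hU1 : ∫⁻ x, ‖deriv (bumpTrain χ c N K) x‖ₑ ^ 2 = ENNReal.ofReal (c ^ 2) * (A * C₁) := by
    have h1 := lintegral_bumpTrain hdχ.continuous (deriv_eq_zero_of_support hsupp) hN hc0 K
    rw [← hA, ← hC₁] at h1
    rw [← h1, ← lintegral_const_mul' _ _ ENNReal.ofReal_ne_top]
    refine lintegral_congr fun x => ?_
    rw [deriv_bumpTrain hχ, enorm_mul, mul_pow, ENNReal.ofReal_pow hc0.le, ← ofReal_norm (c : ℂ),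
      Complex.norm_real, Real.norm_eq_abs, abs_of_pos hc0]
  have hV0 : ∫⁻ x, ‖modulated χ c x‖ₑ ^ 2 = C₀ := lintegral_modulated χ c
  have hV1 : ∫⁻ x, ‖deriv (modulated χ c) x‖ₑ ^ 2 ≤ 2 * C₁ + ENNReal.ofReal (c ^ 2) * (2 * C₀) :=
    lintegral_deriv_modulated_le hχ hc0.le
  set F := tensorSchwartz hu hv hu' hv' with hF
  obtain ⟨g, hg, hgn⟩ := exists_besselMul_eq_fourier_toLp hs hs1 hc1 F
  have hinv : ENNReal.ofReal ((c ^ 2)⁻¹) * ENNReal.ofReal (c ^ 2) = 1 := by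
    rw [← ENNReal.ofReal_mul (by positivity), inv_mul_cancel₀ (by positivity), ENNReal.ofReal_one]
  have hinv1 : ENNReal.ofReal ((c ^ 2)⁻¹) ≤ 1 := by
    rw [ENNReal.ofReal_le_one]
    exact inv_le_one_of_one_le₀ (one_le_pow₀ hc1)
  have e3 : ENNReal.ofReal (3 / N) = ENNReal.ofReal (1 / N) * 3 := by
    rw [div_eq_mul_one_div, mul_comm, ENNReal.ofReal_mul (by positivity)]
    norm_num
  refine ⟨F.toLp 2 volume, g, hg, ?_, fun τ hτ => ?_⟩
  · rw [hF, lintegral_tensorSchwartz, lintegral_tensorSchwartz_zero, lintegral_tensorSchwartz_one,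
      hU0, hU1, hV0] at hgn
    calc ‖g‖ₑ ^ 2 ≤ ENNReal.ofReal (c ^ (2 * s)) * (2 * (A * C₀ * C₀) +
          ENNReal.ofReal ((c ^ 2)⁻¹) * (ENNReal.ofReal (c ^ 2) * (A * C₁) * C₀ +
            A * C₀ * (2 * C₁ + ENNReal.ofReal (c ^ 2) * (2 * C₀)))) := by
          refine hgn.trans ?_
          gcongr
      _ = ENNReal.ofReal (c ^ (2 * s)) * (A * (2 * C₀ ^ 2 +
          (ENNReal.ofReal ((c ^ 2)⁻¹) * ENNReal.ofReal (c ^ 2)) * (C₀ * C₁) +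
          ENNReal.ofReal ((c ^ 2)⁻¹) * (2 * (C₀ * C₁)) +
          (ENNReal.ofReal ((c ^ 2)⁻¹) * ENNReal.ofReal (c ^ 2)) * (2 * C₀ ^ 2))) := by ring
      _ ≤ ENNReal.ofReal (c ^ (2 * s)) * (ENNReal.ofReal (3 / N) * (2 * C₀ ^ 2 +
          1 * (C₀ * C₁) + 1 * (2 * (C₀ * C₁)) + 1 * (2 * C₀ ^ 2))) := by
          rw [hinv]
          gcongr
      _ = ENNReal.ofReal (c ^ (2 * s) / N) * (3 * (4 * C₀ ^ 2 + 3 * (C₀ * C₁))) := by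
          rw [e3, div_eq_mul_one_div (c ^ (2 * s)), ENNReal.ofReal_mul (by positivity)]
          ring
      _ ≤ _ := by
          gcongr
          exact le_self_add
  -- Here `τ ≤ N/c²`, the derivative of the train costs `c²`, and the mass is `3/N`. The factor
  -- `1/N` pays for summing over the `N` times.
  · have hbound : ∀ j ∈ Finset.range N, ∫⁻ x, ‖boxMean (τ j) (F.toLp 2 volume) x -
        F (x + EuclideanSpace.single (0 : Fin 2) (τ j * c))‖ₑ ^ 2 ≤
        ENNReal.ofReal ((N / c) ^ 2 / N) * (3 * C₁ ^ 2) := fun j hj => by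
      have hj' := Finset.mem_range.1 hj
      obtain ⟨h1, h2⟩ := hτ j hj'
      refine (lintegral_boxMean_sub_translate_le F (τ j) c).trans ?_
      rw [hF, lintegral_tensorSchwartz_mixed, hU1, lintegral_deriv_modulated_sub hχ, ← hC₁]
      have hτ2 : (τ j) ^ 2 ≤ (N / c ^ 2) ^ 2 := by
        refine pow_le_pow_left₀ (le_trans (by positivity) h1) (h2.trans ?_) 2
        gcongr
        exact_mod_cast hj'
      calc ENNReal.ofReal (τ j ^ 2) * (ENNReal.ofReal (c ^ 2) * (A * C₁) * C₁)
          ≤ ENNReal.ofReal ((N / c ^ 2) ^ 2) *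
            (ENNReal.ofReal (c ^ 2) * (ENNReal.ofReal (3 / N) * C₁) * C₁) := by gcongr
        _ = ENNReal.ofReal ((N / c ^ 2) ^ 2) * ENNReal.ofReal (c ^ 2) * ENNReal.ofReal (1 / N) *
            (3 * C₁ ^ 2) := by
            rw [e3]
            ring
        _ = _ := by
            rw [← ENNReal.ofReal_mul (by positivity), ← ENNReal.ofReal_mul (by positivity)]
            congr 2
            field_simp
    have hm : ∀ j, AEMeasurable (fun x => ‖boxMean (τ j) (F.toLp 2 volume) x -
        F (x + EuclideanSpace.single (0 : Fin 2) (τ j * c))‖ₑ ^ 2) (volume : Measure Plane) :=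
      fun j => by
        have h1 : Measurable fun x => boxMean (τ j) (F.toLp 2 volume) x :=
          (Lp.stronglyMeasurable _).measurable
        have h2 : Measurable fun x : Plane =>
            F (x + EuclideanSpace.single (0 : Fin 2) (τ j * c)) :=
          (F.continuous.comp (continuous_add_const _)).measurable
        exact ((h1.sub h2).enorm.pow_const 2).aemeasurable
    refine (measure_le_of_sum_sq (N := N) hm ?_).trans ?_
    · rintro x ⟨hx, hxj⟩
      obtain ⟨j, hj, hj1⟩ := one_le_norm_bumpTrain (fun _ => φ.nonneg) hφ1 hc0
        (by omega : 0 < N) (Nat.lt_succ_self ⌈c / N⌉₊) hx.1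
      refine ⟨j, hj, ?_, hxj j hj⟩
      have h1 := hj1 (τ j) (hτ j hj).1 (hτ j hj).2
      rw [hF, tensorSchwartz_apply, norm_mul]
      have h2 : ‖modulated χ c ((x + EuclideanSpace.single (0 : Fin 2) (τ j * c)) 1)‖ = 1 := by
        have h3 : (x + EuclideanSpace.single (0 : Fin 2) (τ j * c) : Plane) 1 = x 1 := by simp
        have h4 : φ (x 1) = 1 := hφ1 _ (by rw [abs_of_nonneg hx.2.1]; exact hx.2.2)
        rw [h3, modulated, norm_mul, mul_comm Complex.I, Complex.norm_exp_ofReal_mul_I, hχ_def]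
        simp [h4]
      rw [h2, mul_one]
      have h5 : (x + EuclideanSpace.single (0 : Fin 2) (τ j * c) : Plane) 0 = x 0 + τ j * c := by
        simp
      rw [h5]
      exact h1
    · calc _ ≤ 4 * (N • (ENNReal.ofReal ((N / c) ^ 2 / N) * (3 * C₁ ^ 2))) := by
            gcongr
            have := Finset.sum_le_card_nsmul _ _ _ hbound
            rwa [Finset.card_range] at this
        _ = ENNReal.ofReal (N * ((N / c) ^ 2 / N)) * (12 * C₁ ^ 2) := by
            rw [nsmul_eq_mul, ENNReal.ofReal_mul (by positivity), ENNReal.ofReal_natCast]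
            ring
        _ ≤ _ := by
            rw [mul_div_cancel₀ _ hN0.ne']
            gcongr
            exact le_add_self

end TestFunction

/-! ### Necessity of the weak Lorentz condition. -/

/-- The mean at time `t` of the function whose Bessel potential of order `s` has Fourier
transform `g`. -/
noncomputable def besselMean {s : ℝ} (hs : 0 ≤ s) (t : ℝ) (g : Lp ℂ 2 (volume : Measure Plane)) :
    Lp ℂ 2 (volume : Measure Plane) :=
  boxMean t (𝓕⁻ (besselMul hs g))

section BesselMean

variable {s : ℝ} (hs : 0 ≤ s) (t : ℝ)

theorem coeFn_fourier_besselMean (g : Lp ℂ 2 (volume : Measure Plane)) :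
    ⇑(𝓕 (besselMean hs t g) : Lp ℂ 2 (volume : Measure Plane)) =ᵐ[volume]
      fun η => boxSymbol t η * (besselWeight s η * g η) := by
  unfold besselMean
  have h := coeFn_fourier_boxMean t (𝓕⁻ (besselMul hs g))
  rw [FourierTransform.fourier_fourierInv_eq] at h
  filter_upwards [h, coeFn_besselMul hs g] with η h1 h2
  rw [h1, h2]

theorem besselMean_sub (g h : Lp ℂ 2 (volume : Measure Plane)) :
    besselMean hs t (g - h) = besselMean hs t g - besselMean hs t h := by
  refine (Lp.fourierTransformₗᵢ Plane ℂ).injective ?_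
  rw [map_sub]
  refine Lp.ext ?_
  filter_upwards [coeFn_fourier_besselMean hs t (g - h), coeFn_fourier_besselMean hs t g,
    coeFn_fourier_besselMean hs t h, Lp.coeFn_sub g h,
    Lp.coeFn_sub (𝓕 (besselMean hs t g)) (𝓕 (besselMean hs t h))] with η h1 h2 h3 h4 h5
  refine h1.trans (Eq.trans ?_ h5.symm)
  rw [Pi.sub_apply, h2, h3, h4, Pi.sub_apply]
  ring

theorem besselMean_smul (a : ℂ) (g : Lp ℂ 2 (volume : Measure Plane)) :
    besselMean hs t (a • g) = a • besselMean hs t g := by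
  refine (Lp.fourierTransformₗᵢ Plane ℂ).injective ?_
  rw [map_smul]
  refine Lp.ext ?_
  filter_upwards [coeFn_fourier_besselMean hs t (a • g), coeFn_fourier_besselMean hs t g,
    Lp.coeFn_smul a g, Lp.coeFn_smul a (𝓕 (besselMean hs t g))] with η h1 h2 h3 h4
  refine h1.trans (Eq.trans ?_ h4.symm)
  rw [Pi.smul_apply, h2, h3, Pi.smul_apply, smul_eq_mul, smul_eq_mul]
  ring

theorem norm_besselMean_le (g : Lp ℂ 2 (volume : Measure Plane)) : ‖besselMean hs t g‖ ≤ ‖g‖ := by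
  rw [← Lp.norm_fourier_eq (besselMean hs t g)]
  refine Lp.norm_le_norm_of_ae_le ?_
  filter_upwards [coeFn_fourier_besselMean hs t g] with η h
  rw [h, norm_mul, norm_mul, norm_boxSymbol, one_mul, norm_besselWeight]
  exact mul_le_of_le_one_left (norm_nonneg _)
    (Real.rpow_le_one_of_one_le_of_nonpos (by simp) (by linarith))

end BesselMean

theorem exists_pos_forall_rpow_lt {p ε : ℝ} (hp : 0 < p) (hε : 0 < ε) :
    ∃ δ > 0, ∀ b : ℝ, 0 < b → b < δ → b ^ p < ε := by
  refine ⟨ε ^ p⁻¹, by positivity, fun b hb h => ?_⟩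
  calc b ^ p < (ε ^ p⁻¹) ^ p := Real.rpow_lt_rpow hb.le h hp
    _ = ε := Real.rpow_inv_rpow hε.le hp.ne'

/-- Scales at which the weak Lorentz condition fails badly: `N` is the number of separated times
available at scale `b`. -/
theorem exists_bad_scale {s : ℝ} (hs : 0 < s) (hs' : s < 1 / 2) {t : ℕ → ℝ} (ht_lt : ∀ n, t n < 1)
    (ht_anti : Antitone t) (ht_lim : Tendsto t atTop (𝓝 0))
    (ht_gap : Antitone fun n => t n - t (n + 1)) (hw : ¬ MemWeakLorentz (s / (1 - s)) t) {ε : ℝ}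
    (hε : 0 < ε) :
    ∃ (N : ℕ) (c : ℝ), 5 ≤ N ∧ N ≤ c ∧ c ^ (2 * s) / N < ε ∧ (N / c) ^ 2 < ε ∧
      ∃ n : ℕ → ℕ, ∀ j < N, j / c ^ 2 ≤ t (n j) ∧ t (n j) ≤ (j + 1) / c ^ 2 := by
  set r := s / (1 - s) with hr
  have h1s : 0 < 1 - s := by linarith
  have hr0 : 0 < r := div_pos hs h1s
  have hr1 : r < 1 := by
    rw [hr, div_lt_one h1s]
    linarith
  have hrs : r * (1 - s) = s := by
    rw [hr]
    field_simp
  -- `m^{-(1-s)}` will bound `c^{2s}/N`. Taking `M = 2m` absorbs the floor in `N`, so that `N ≥ m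
  -- b^{-r}`.
  obtain ⟨m, hm1, hm⟩ : ∃ m : ℝ, 1 ≤ m ∧ m ^ (-(1 - s)) < ε :=
    ((eventually_ge_atTop 1).and
      ((tendsto_rpow_neg_atTop h1s).eventually (gt_mem_nhds hε))).exists
  have hm0 : 0 < m := by linarith
  set M := 2 * m with hM
  obtain ⟨δ₁, hδ₁, h₁⟩ := exists_pos_forall_rpow_lt (p := 1 - r) (by linarith)
    (by positivity : 0 < min 1 ε / M)
  obtain ⟨δ₂, hδ₂, h₂⟩ := exists_pos_forall_rpow_lt hr0 (by norm_num : (0 : ℝ) < 1 / 6)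
  obtain ⟨b, hb, hbδ, hdense⟩ := exists_dense_times hr0 ht_lt ht_anti ht_lim ht_gap hw
    (M := M) (by positivity) (lt_min hδ₁ hδ₂)
  have hb1 := h₁ b hb (hbδ.trans_le (min_le_left _ _))
  have hb2 := h₂ b hb (hbδ.trans_le (min_le_right _ _))
  have hbr : 6 ≤ b ^ (-r) := by
    rw [Real.rpow_neg hb.le, le_inv_comm₀ (by norm_num) (by positivity)]
    linarith
  have hMb : 12 ≤ M * b ^ (-r) := by nlinarith
  set N := ⌊M * b ^ (-r)⌋₊ with hN
  have hN1 : (N : ℝ) ≤ M * b ^ (-r) := Nat.floor_le (by linarith)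
  have hN2 : M * b ^ (-r) < N + 1 := Nat.lt_floor_add_one _
  have hN5 : 5 ≤ N := Nat.le_floor (by push_cast; linarith)
  have hN5' : (5 : ℝ) ≤ N := by exact_mod_cast hN5
  have hN0 : (0 : ℝ) < N := by linarith
  have hNb : N * b < min 1 ε := by
    rw [lt_div_iff₀ (by positivity)] at hb1
    calc N * b ≤ M * b ^ (-r) * b := by gcongr
      _ = b ^ (1 - r) * M := by
        rw [sub_eq_add_neg, Real.rpow_add hb, Real.rpow_one]
        ring
      _ < _ := hb1
  have hcc : √(N / b) ^ 2 = N / b := Real.sq_sqrt (by positivity)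
  have hc0 : 0 < √(N / b) := by positivity
  -- This `c` makes `1 / c ^ 2 = b / N`, the mesh at which the times are dense.
  refine ⟨N, √(N / b), hN5, ?_, ?_, ?_, ?_⟩
  · refine Real.le_sqrt_of_sq_le ?_
    rw [le_div_iff₀ hb]
    nlinarith [hNb.trans_le (min_le_left _ _)]
  · have e1 : √(N / b) ^ (2 * s) = (N / b) ^ s := by
      rw [Real.rpow_mul hc0.le, Real.rpow_two, hcc]
    have hmN : m * b ^ (-r) ≤ N := by linarith
    have h1 : (N : ℝ) ^ (-(1 - s)) ≤ (m * b ^ (-r)) ^ (-(1 - s)) :=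
      Real.rpow_le_rpow_of_nonpos (by positivity) hmN (by linarith)
    have h2 : (m * b ^ (-r)) ^ (-(1 - s)) = m ^ (-(1 - s)) * b ^ s := by
      rw [Real.mul_rpow hm0.le (by positivity), ← Real.rpow_mul hb.le]
      congr 2
      linarith
    have h3 : (N / b) ^ s / N = N ^ (-(1 - s)) * (b ^ s)⁻¹ := by
      rw [Real.div_rpow hN0.le hb.le, show -(1 - s) = s - 1 by ring, Real.rpow_sub_one hN0.ne']
      ring
    rw [e1, h3]
    calc N ^ (-(1 - s)) * (b ^ s)⁻¹ ≤ (m ^ (-(1 - s)) * b ^ s) * (b ^ s)⁻¹ := by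
          rw [← h2]
          gcongr
      _ = m ^ (-(1 - s)) := by
          rw [mul_assoc, mul_inv_cancel₀ (by positivity), mul_one]
      _ < ε := hm
  · rw [div_pow, hcc]
    have : (N : ℝ) ^ 2 / (N / b) = N * b := by field_simp
    rw [this]
    exact hNb.trans_le (min_le_right _ _)
  · choose! n hn using hdense N hN1
    refine ⟨n, fun j hj => ?_⟩
    have e : ∀ y : ℝ, y / √(N / b) ^ 2 = y * (b / N) := fun y => by
      rw [hcc]
      field_simp
    rw [e, e]
    exact hn j hj

theorem iSup_enorm_lt_top_of_tendsto {a : ℕ → ℂ} {l : ℂ} (h : Tendsto a atTop (𝓝 l)) :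
    ⨆ n, ‖a n‖ₑ < ∞ := by
  obtain ⟨B, hB⟩ := h.norm.bddAbove_range
  refine lt_of_le_of_lt (iSup_le fun n => ?_) (ENNReal.ofReal_lt_top (r := B))
  rw [← ofReal_norm]
  exact ENNReal.ofReal_le_ofReal (hB ⟨n, rfl⟩)

theorem memWeakLorentz_of_tendsto_boxMean {s : ℝ} (hs : 0 < s) (hs' : s < 1 / 2) {t : ℕ → ℝ}
    (ht_lt : ∀ n, t n < 1) (ht_anti : Antitone t) (ht_lim : Tendsto t atTop (𝓝 0))
    (ht_gap : Antitone fun n => t n - t (n + 1))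
    (hconv : ∀ f : Lp ℂ 2 (volume : Measure Plane),
      TemperedDistribution.MemSobolev s 2 (f : 𝓢'(Plane, ℂ)) →
        ∀ᵐ x : Plane, Tendsto (fun n => boxMean (t n) f x) atTop (𝓝 (f x))) :
    MemWeakLorentz (s / (1 - s)) t := by
  by_contra hw
  have hbdd : ∀ g, ∀ᵐ x : Plane, ⨆ n, ‖besselMean hs.le (t n) g x‖ₑ < ∞ := fun g => by
    have hf := (memSobolev_iff_exists_fourier_eq_besselMul hs.le (𝓕⁻ (besselMul hs.le g))).2
      ⟨g, FourierTransform.fourier_fourierInv_eq _⟩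
    filter_upwards [hconv _ hf] with x hx
    exact iSup_enorm_lt_top_of_tendsto hx
  -- With `ε = 1/8` the set where the maximal function reaches `C` has measure at most `1/4`. The
  -- exceptional set of the test function will have measure at most `1/2`, so the two cannot cover
  -- the unit square.
  obtain ⟨ρ, hρ, C, hC, hmax⟩ := exists_uniform_maxFunctional_le (Q := unitSquare)
    (by rw [volume_unitSquare]; simp) (fun n => besselMean_sub hs.le (t n))
    (fun n => norm_besselMean_le hs.le (t n)) hbdd (ε := 8⁻¹) (by simp)
  obtain ⟨B, hB, htest⟩ := exists_test_function
  lift B to NNReal using hB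
  have hC0 : (0 : ℝ) < C := by exact_mod_cast Nat.pos_of_ne_zero hC
  obtain ⟨N, c, hN5, hNc, hc1, hc2, n, hn⟩ := exists_bad_scale hs hs' ht_lt ht_anti ht_lim ht_gap hw
    (ε := min (ρ ^ 2 / (4 * C ^ 2 * (B + 1))) (1 / (2 * (B + 1)))) (by positivity)
  obtain ⟨f, g, hfg, hg, hbad⟩ := htest s hs.le (by linarith) N c hN5 hNc
  have hN0 : (0 : ℝ) < N := by
    have : 0 < N := by omega
    exact_mod_cast this
  have hcpos : 0 < c := hN0.trans_le hNc
  have hB0 : (0 : ℝ) ≤ B := B.coe_nonneg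
  have hBe : (B : ℝ≥0∞) = ENNReal.ofReal B := by simp
  have hf : f = 𝓕⁻ (besselMul hs.le g) := by
    rw [← hfg, FourierTransform.fourierInv_fourier_eq]
  -- Scaling by `2C` turns means above `1/2` into means above `C`. The smallness of `g` was chosen
  -- to keep `a • g` inside the ball of radius `ρ`.
  set a : ℂ := ((2 * C : ℝ) : ℂ) with ha
  have hnorm_a : ‖a‖ = 2 * C := by
    rw [ha, Complex.norm_real, Real.norm_eq_abs, abs_of_pos (by positivity)]
  have hsmall : ‖a • g‖ < ρ := by
    rw [norm_smul, hnorm_a]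
    refine lt_of_pow_lt_pow_left₀ 2 hρ.le ?_
    have h1 : ‖g‖ ^ 2 ≤ c ^ (2 * s) / N * B := by
      rw [← ofReal_norm, ← ENNReal.ofReal_pow (norm_nonneg _), hBe,
        ← ENNReal.ofReal_mul (by positivity)] at hg
      exact (ENNReal.ofReal_le_ofReal_iff (by positivity)).1 hg
    have h2 := hc1.trans_le (min_le_left _ _)
    rw [lt_div_iff₀ (by positivity)] at h2
    have h3 : 0 < c ^ (2 * s) / N := by positivity
    calc (2 * C * ‖g‖) ^ 2 = 4 * C ^ 2 * ‖g‖ ^ 2 := by ring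
      _ ≤ 4 * C ^ 2 * (c ^ (2 * s) / N * B) := by gcongr
      _ ≤ c ^ (2 * s) / N * (4 * C ^ 2 * (B + 1)) := by
        have : 0 ≤ 4 * (C : ℝ) ^ 2 * (c ^ (2 * s) / N) := by positivity
        nlinarith
      _ < ρ ^ 2 := h2
  have hle := hmax (a • g) hsmall ((Finset.range N).sup n + 1)
  set h : Plane → ℝ≥0∞ := fun x => min 1 ((C : ℝ≥0∞)⁻¹ *
    (Finset.range ((Finset.range N).sup n + 1)).sup fun n => ‖besselMean hs.le (t n) (a • g) x‖ₑ)
    with hh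
  have hhm : Measurable h := measurable_const.min ((measurable_sup_enorm
    (T := fun n => besselMean hs.le (t n)) ((Finset.range N).sup n + 1) (a • g)).const_mul _)
  set bad := {x ∈ unitSquare | ∀ j < N, ‖boxMean (t (n j)) f x‖ ≤ 1 / 2} with hbad_def
  have hbad' : volume bad ≤ 2⁻¹ := by
    refine (hbad (fun j => t (n j)) hn).trans ?_
    rw [hBe, ← ENNReal.ofReal_mul (by positivity)]
    have h2 := hc2.trans_le (min_le_right _ _)
    rw [lt_div_iff₀ (by positivity)] at h2
    have h3 : (2⁻¹ : ℝ≥0∞) = ENNReal.ofReal 2⁻¹ := by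
      rw [ENNReal.ofReal_inv_of_pos (by norm_num)]
      norm_num
    rw [h3]
    refine ENNReal.ofReal_le_ofReal ?_
    nlinarith [sq_nonneg (N / c : ℝ)]
  have hcover : (unitSquare : Set Plane) ≤ᵐ[volume]
      (bad ∪ ({x | 1 ≤ h x} ∩ unitSquare) : Set _) := by
    have hsmul : ∀ᵐ x : Plane, ∀ k, besselMean hs.le (t k) (a • g) x = a * boxMean (t k) f x := by
      refine ae_all_iff.2 fun k => ?_
      rw [besselMean_smul, besselMean, ← hf]
      filter_upwards [Lp.coeFn_smul a (boxMean (t k) f)] with x hx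
      rw [hx, Pi.smul_apply, smul_eq_mul]
    filter_upwards [hsmul] with x hx hxQ
    by_cases hxb : ∀ j < N, ‖boxMean (t (n j)) f x‖ ≤ 1 / 2
    · exact Or.inl ⟨hxQ, hxb⟩
    · push Not at hxb
      obtain ⟨j, hj, hjx⟩ := hxb
      refine Or.inr ⟨show 1 ≤ h x from le_min le_rfl ?_, hxQ⟩
      have h1 : (C : ℝ≥0∞) ≤ ‖besselMean hs.le (t (n j)) (a • g) x‖ₑ := by
        rw [hx, ← ofReal_norm, norm_mul, hnorm_a, ← ENNReal.ofReal_natCast]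
        refine ENNReal.ofReal_le_ofReal ?_
        nlinarith
      have h2 : ‖besselMean hs.le (t (n j)) (a • g) x‖ₑ ≤
          (Finset.range ((Finset.range N).sup n + 1)).sup
            fun n => ‖besselMean hs.le (t n) (a • g) x‖ₑ :=
        Finset.le_sup (f := fun n => ‖besselMean hs.le (t n) (a • g) x‖ₑ)
          (Finset.mem_range.2 (Nat.lt_succ_iff.2 (Finset.le_sup (Finset.mem_range.2 hj))))
      calc (1 : ℝ≥0∞) = (C : ℝ≥0∞)⁻¹ * C :=
            (ENNReal.inv_mul_cancel (by exact_mod_cast hC) (by simp)).symm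
        _ ≤ _ := mul_le_mul_right (h1.trans h2) _
  have hmarkov : volume ({x | 1 ≤ h x} ∩ unitSquare) ≤ 2 * 8⁻¹ := by
    have h1 := mul_meas_ge_le_lintegral (μ := volume.restrict unitSquare) hhm 1
    rw [one_mul, Measure.restrict_apply (measurableSet_le measurable_const hhm)] at h1
    exact h1.trans hle
  have htotal : (1 : ℝ≥0∞) ≤ 2⁻¹ + 2 * 8⁻¹ := by
    rw [← volume_unitSquare]
    exact (measure_mono_ae hcover).trans ((measure_union_le _ _).trans (add_le_add hbad' hmarkov))
  have h4 : (2⁻¹ + 2 * 8⁻¹ : ℝ≥0∞) = ENNReal.ofReal (3 / 4) := by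
    rw [show (3 / 4 : ℝ) = 2⁻¹ + 2 * 8⁻¹ by norm_num,
      ENNReal.ofReal_add (by norm_num) (by norm_num), ENNReal.ofReal_mul (by norm_num), ENNReal.ofReal_inv_of_pos (by norm_num),
      ENNReal.ofReal_inv_of_pos (by norm_num)]
    norm_num
  rw [h4, ENNReal.one_le_ofReal] at htotal
  norm_num at htotal

theorem theorem1p1 (s : ℝ) (hs : 0 < s) (hs' : s < 1 / 2) (t : ℕ → ℝ)
    (ht_mem : ∀ n, t n ∈ Set.Ioo (0 : ℝ) 1)
    (ht_anti : Antitone t)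
    (ht_lim : Tendsto t atTop (𝓝 0))
    (ht_gap : Antitone fun n => t n - t (n + 1)) :
    (∀ f : Lp ℂ 2 (volume : Measure Plane),
        TemperedDistribution.MemSobolev s 2 (f : 𝓢'(Plane, ℂ)) →
        ∀ᵐ x : Plane, Tendsto (fun n => boxMean (t n) f x) atTop (𝓝 (f x))) ↔
      MemWeakLorentz (s / (1 - s)) t :=
  ⟨memWeakLorentz_of_tendsto_boxMean hs hs' (fun n => (ht_mem n).2) ht_anti ht_lim ht_gap,
    fun hw _ hf => tendsto_boxMean_of_memWeakLorentz hs hs' ht_mem ht_lim hw hf⟩
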